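/- Let $(\Omega,\mathfrak A,P)$ be a probability space, $X:\Omega\to\mathcal X\subset\mathbb R^{d_x}$ covariates, $Z:\Omega\to\mathcal Z\subset\mathbb R^{d_z}$ an instrument, and let $\omega\mapsto\mathcal Y_1(\omega)\times\mathcal Y_0(\omega)$, with $\mathcal Y_1(\omega),\mathcal Y_0(\omega)\subset\mathbb R$, be a random closed set in $\mathbb R^2$ that is integrable (it has an integrable measurable selection) and almost surely convex. Call a random vector $(Y_1,Y_0)$ admissible if it is integrable, satisfies $(Y_1,Y_0)\in\mathcal Y_1\times\mathcal Y_0$ a.s., and $E[Y_d\mid X,Z]=E[Y_d\mid X]$ a.s. for $d=0,1$. Assume that the true potential outcomes are admissible. Let $\delta,\delta^*:\mathcal X\to\{0,1\}$ be treatment rules, $\theta_{10}(X)=\mathbf 1\{\delta(X)=1,\delta^*(X)=0\}$, $\theta_{01}(X)=\mathbf 1\{\delta(X)=0,\delta^*(X)=1\}$, and let $$B_I(\delta,\delta^*)=\bigl\{E\bigl[E[Y_1-Y_0\mid X]\,(\delta(X)-\delta^*(X))\bigr] : (Y_1,Y_0)\ \text{admissible}\bigr\}$$ be the sharp identified set of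 the welfare gain. Write $s(v,K)=\sup_{y\in K}\langle v,y\rangle\in[-\infty,\infty]$ for the support function, $v_1=(1,0)$, $v_0=(0,1)$, $\mathcal Y=\mathcal Y_1\times\mathcal Y_0$, and $$\underline\Delta(X)=\sup_{z\in\mathcal Z}\bigl\{-E[s(-v_1,\mathcal Y)\mid X,Z=z]\bigr\}-\inf_{z\in\mathcal Z}E[s(v_0,\mathcal Y)\mid X,Z=z],$$ $$\overline\Delta(X)=\inf_{z\in\mathcal Z}E[s(v_1,\mathcal Y)\mid X,Z=z]-\sup_{z\in\mathcal Z}\bigl\{-E[s(-v_0,\mathcal Y)\mid X,Z=z]\bigr\}.$$ Here, since conditional expectations given $Z=z$ are defined only up to null sets, $\sup_z$ and $\inf_z$ are the essential supremum and infimum with respect to the conditional law of $Z$ given $X$. Then $B_I(\delta,\delta^*)$ is the interval $[\beta_l,\beta_u]$, i.e. $\{\beta\in\mathbb R:\beta_l\le\beta\le\beta_u\}$, where $$\beta_l=E\bigl[\underline\Delta(X)\theta_{10}(X)-\overline\Delta(X)\theta_{01}(X)\bigr],\qquad \beta_u=E\bigl[\overline\Delta(X)\theta_{10}(X)-\underline\Delta(X)\theta_{01}(X)\bigr]$$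 are well-defined extended real numbers. Moreover, the same holds with $\sup$ and $\inf$ over all points $z\in\mathcal Z$ whenever versions of the conditional expectations are used such that, for almost every $x$, each $z\in\mathcal Z$ either is an atom of the conditional law of $Z$ given $X=x$, or lies in its support and is a point of continuity on $\mathcal Z$ of these versions (as functions of $z$). In particular, this is so for every choice of versions if $\mathcal Z$ is countable and $P(Z=z\mid X)>0$ a.s. for each $z\in\mathcal Z$. -/

import Mathlib

open MeasureTheory ProbabilityTheory Filter Topology

noncomputable section

namespace WelfareGain

/-- The plane of potential outcome pairs. Coordinate `0` holds `Y₁` (outcome under treatment) and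
coordinate `1` holds `Y₀` (outcome without treatment). -/
abbrev Plane : Type := EuclideanSpace ℝ (Fin 2)

/-- The direction `v₁ = (1, 0)`, which picks out `Y₁`. -/
def v₁ : Plane := !₂[1, 0]

/-- The direction `v₀ = (0, 1)`, which picks out `Y₀`. -/
def v₀ : Plane := !₂[0, 1]

/-! ### Random sets -/

section RandomSets

variable {Ω : Type*} [MeasurableSpace Ω]

/-- A random closed set: closed values, and every compact set is hit on a measurable event. -/
def IsRandomClosedSet (F : Ω → Set Plane) : Prop :=
  (∀ ω, IsClosed (F ω)) ∧ ∀ K : Set Plane, IsCompact K → MeasurableSet {ω | (F ω ∩ K).Nonempty}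

/-- `ξ` is a measurable selection of `F`. -/
def IsSelection (F : Ω → Set Plane) (μ : Measure Ω) (ξ : Ω → Plane) : Prop :=
  Measurable ξ ∧ ∀ᵐ ω ∂μ, ξ ω ∈ F ω

/-- An integrable random set: a random closed set that has an integrable selection. -/
def IsIntegrableRandomSet (F : Ω → Set Plane) (μ : Measure Ω) : Prop :=
  IsRandomClosedSet F ∧ ∃ ξ, IsSelection F μ ξ ∧ Integrable ξ μ

/-- The random set `ω ↦ 𝒴₁(ω) × 𝒴₀(ω)`. -/
def prodSet (𝒴₁ 𝒴₀ : Ω → Set ℝ) (ω : Ω) : Set Plane := {y | y 0 ∈ 𝒴₁ ω ∧ y 1 ∈ 𝒴₀ ω}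

/-- The support function `s(v, K) = sup_{x ∈ K} ⟨v, x⟩`, with values in `[-∞, ∞]`. -/
def supportFun (v : Plane) (K : Set Plane) : EReal := ⨆ x ∈ K, ((inner ℝ v x : ℝ) : EReal)

end RandomSets

/-! ### Expectations of extended real random variables -/

/-- The expectation `∫ f⁺ - ∫ f⁻` of an extended real function. -/
def emean {Ω : Type*} [MeasurableSpace Ω] (ν : Measure Ω) (f : Ω → EReal) : EReal :=
  ((∫⁻ ω, (f ω).toENNReal ∂ν : ENNReal) : EReal) -
    ((∫⁻ ω, (-f ω).toENNReal ∂ν : ENNReal) : EReal)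

/-- The expectation of `f` is well defined: it is not of the form `∞ - ∞`. -/
def HasMean {Ω : Type*} [MeasurableSpace Ω] (ν : Measure Ω) (f : Ω → EReal) : Prop :=
  ∫⁻ ω, (f ω).toENNReal ∂ν ≠ ⊤ ∨ ∫⁻ ω, (-f ω).toENNReal ∂ν ≠ ⊤

/-- `E[S | W = w]`: the mean of the regular conditional distribution of `S` given `W = w`. As a
function of `w` it is determined up to null sets of the law of `W`. -/
def condMean {Ω 𝒲 : Type*} [MeasurableSpace Ω] [MeasurableSpace 𝒲] (μ : Measure Ω)
    [IsFiniteMeasure μ] (S : Ω → EReal) (W : Ω → 𝒲) (w : 𝒲) : EReal :=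
  emean (condDistrib S W μ w) id

/-! ### Bounds on conditional means that use the instrument -/

section Instrument

variable {Ω 𝒳 : Type*} [MeasurableSpace Ω] [MeasurableSpace 𝒳] {dz : ℕ}

/-- `sup_z { -E[s(-v, F) | X = x, Z = z] }`. The supremum is the essential one for the conditional
law of `Z` given `X = x`, so that it does not depend on the version of the conditional
expectation. -/
def ivLower (F : Ω → Set Plane) (μ : Measure Ω) [IsFiniteMeasure μ] (X : Ω → 𝒳)
    (Z : Ω → EuclideanSpace ℝ (Fin dz)) (v : Plane) (x : 𝒳) : EReal :=
  essSup (fun z => -condMean μ (fun ω => supportFun (-v) (F ω)) (fun ω => (X ω, Z ω)) (x, z))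
    (condDistrib Z X μ x)

/-- `inf_z { E[s(v, F) | X = x, Z = z] }`, with the essential infimum for the conditional law of
`Z` given `X = x`. -/
def ivUpper (F : Ω → Set Plane) (μ : Measure Ω) [IsFiniteMeasure μ] (X : Ω → 𝒳)
    (Z : Ω → EuclideanSpace ℝ (Fin dz)) (v : Plane) (x : 𝒳) : EReal :=
  essInf (fun z => condMean μ (fun ω => supportFun v (F ω)) (fun ω => (X ω, Z ω)) (x, z))
    (condDistrib Z X μ x)

/-- `g x z` is a version of `E[S | X = x, Z = z]` whose value at every single point `z` of `𝒵` is
meaningful: for almost every `x`, each `z ∈ 𝒵` is an atom of the conditional law of `Z` given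
`X = x`, or it lies in the support of that law and `g x` is continuous at `z` on `𝒵`. If `𝒵` is
countable and `P(Z = z | X) > 0` a.s. for each `z ∈ 𝒵`, then every version has this property. -/
def IsPointwiseVersion (μ : Measure Ω) [IsFiniteMeasure μ] (X : Ω → 𝒳)
    (Z : Ω → EuclideanSpace ℝ (Fin dz)) (𝒵 : Set (EuclideanSpace ℝ (Fin dz))) (S : Ω → EReal)
    (g : 𝒳 → EuclideanSpace ℝ (Fin dz) → EReal) : Prop :=
  (∀ᵐ p ∂(μ.map fun ω => (X ω, Z ω)), g p.1 p.2 = condMean μ S (fun ω => (X ω, Z ω)) p) ∧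
  ∀ᵐ x ∂(μ.map X), ∀ z ∈ 𝒵, 0 < condDistrib Z X μ x {z} ∨
    ((∀ U ∈ 𝓝[𝒵] z, 0 < condDistrib Z X μ x U) ∧ ContinuousWithinAt (g x) 𝒵 z)

/-- Mean independence of the instrument: `E[Y_d | X, Z] = E[Y_d | X]` a.s. for `d = 1, 0`. -/
def MeanIndependent (μ : Measure Ω) (X : Ω → 𝒳) (Z : Ω → EuclideanSpace ℝ (Fin dz))
    (Y : Ω → Plane) : Prop :=
  ∀ i : Fin 2,
    μ[fun ω => Y ω i | MeasurableSpace.comap (fun ω => (X ω, Z ω)) inferInstance] =ᵐ[μ]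
      μ[fun ω => Y ω i | MeasurableSpace.comap X inferInstance]

/-- `(Y₁, Y₀)` is an integrable selection of `F` for which the instrument is mean independent. -/
def IsAdmissible (F : Ω → Set Plane) (μ : Measure Ω) (X : Ω → 𝒳)
    (Z : Ω → EuclideanSpace ℝ (Fin dz)) (Y : Ω → Plane) : Prop :=
  IsSelection F μ Y ∧ Integrable Y μ ∧ MeanIndependent μ X Z Y

end Instrument

/-! ### The welfare gain -/

section Welfare

variable {Ω 𝒳 : Type*} [MeasurableSpace Ω] [MeasurableSpace 𝒳]

/-- The value `δ(x) ∈ {0, 1}` of a treatment rule as a real number. -/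
def treat (δ : 𝒳 → Bool) (x : 𝒳) : ℝ := if δ x = true then 1 else 0

/-- The welfare gain `E[E[Y₁ - Y₀ | X] (δ(X) - δ*(X))]` of `δ` over `δ'` (which is `δ*`). -/
def welfareGain (μ : Measure Ω) (X : Ω → 𝒳) (δ δ' : 𝒳 → Bool) (Y : Ω → Plane) : ℝ :=
  ∫ ω, (μ[fun ω => Y ω 0 - Y ω 1 | MeasurableSpace.comap X inferInstance]) ω *
    (treat δ (X ω) - treat δ' (X ω)) ∂μ

/-- The sharp identified region: all welfare gains that come from admissible `(Y₁, Y₀)`. -/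
def identifiedSet {dz : ℕ} (F : Ω → Set Plane) (μ : Measure Ω) (X : Ω → 𝒳)
    (Z : Ω → EuclideanSpace ℝ (Fin dz)) (δ δ' : 𝒳 → Bool) : Set ℝ :=
  {β | ∃ Y, IsAdmissible F μ X Z Y ∧ β = welfareGain μ X δ δ' Y}

/-- The indicator of `{δ(x) = 1, δ*(x) = 0}`; `newlyTreated δ' δ` is that of
`{δ(x) = 0, δ*(x) = 1}`. -/
def newlyTreated (δ δ' : 𝒳 → Bool) (x : 𝒳) : EReal :=
  if δ x = true ∧ δ' x = false then 1 else 0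

/-- `A(x) θ₁₀(x) - B(x) θ₀₁(x)`. -/
def gainIntegrand (A B : 𝒳 → EReal) (δ δ' : 𝒳 → Bool) (x : 𝒳) : EReal :=
  A x * newlyTreated δ δ' x - B x * newlyTreated δ' δ x

/-- The real points of `[β_l, β_u]`, where `β_l = E[Δlo(X) θ₁₀(X) - Δhi(X) θ₀₁(X)]` and
`β_u = E[Δhi(X) θ₁₀(X) - Δlo(X) θ₀₁(X)]`. -/
def gainInterval (μ : Measure Ω) (X : Ω → 𝒳) (δ δ' : 𝒳 → Bool) (Δlo Δhi : 𝒳 → EReal) : Set ℝ :=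
  {β | emean μ (fun ω => gainIntegrand Δlo Δhi δ δ' (X ω)) ≤ (β : EReal) ∧
    (β : EReal) ≤ emean μ (fun ω => gainIntegrand Δhi Δlo δ δ' (X ω))}

end Welfare

end WelfareGain

end

namespace WelfareGain

open scoped ENNReal

/-! ### Telescoping sums and essential infima -/

/-! Fix an admissible `Y`. In a direction `v`, the support function equals `⟨v, Y⟩` plus a slack
with values in `[0, ∞]`. Mean independence makes `E[⟨v, Y⟩ | X, Z]` a function of `X` alone, so the
infimum over `z` acts only on the slack: `ivUpper` in direction `v` is the regression of `⟨v, Y⟩` on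
`X` plus a margin, the essential infimum over `z` of the conditional mean of the slack. By negation,
`ivLower` is the regression minus the margin in direction `-v`. Substituted into the bounds, this
gives `emean_gainIntegrand`: the lower endpoint is the welfare gain of `Y` minus a total margin in
`[0, ∞]`. In particular it lies below the gain of every admissible pair, and a real number plus a
nonnegative quantity never produces `∞ - ∞`.

For sharpness, let `t` be at most the total margin. Spread `t` as a function `ρ(x)` below the
pointwise margins (`exists_le_lintegral_eq`). Since `ρ(X)` is at most the conditional mean of the
slack given `(X, Z)`, there is a random amount below the slack whose conditional mean is exactly
`ρ(X)` (`exists_le_setLIntegral_eq`). Moving the coordinates of `Y` by such amounts stays in the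
closed convex product set, and keeps mean independence because the conditional mean of the move
depends on `X` only. The gain drops by exactly `t` (`exists_isAdmissible_welfareGain_sub`).

Exchanging the two rules negates the gain and swaps the endpoints, so the upper half follows from
the lower half. For pointwise versions, essential infima agree with infima over all points
(`essInf_eq_biInf`). -/

theorem tsum_tsub_eq_iSup {u : ℕ → ℝ≥0∞} (hu : Monotone u) (h0 : u 0 = 0) :
    ∑' n, (u (n + 1) - u n) = ⨆ n, u n := by
  have h : ∀ n, ∑ i ∈ Finset.range n, (u (i + 1) - u i) = u n := by
    intro n
    induction n with
    | zero => simp [h0]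
    | succ n ih => rw [Finset.sum_range_succ, ih, add_tsub_cancel_of_le (hu n.le_succ)]
  rw [ENNReal.tsum_eq_iSup_nat]
  simp_rw [h]

theorem iSup_min_natCast (a : ℝ≥0∞) : ⨆ n : ℕ, min a n = a := by
  have : ⨆ n : ℕ, a ⊓ (n : ℝ≥0∞) = a ⊓ ⨆ n : ℕ, (n : ℝ≥0∞) := (inf_iSup_eq a _).symm
  simpa [ENNReal.iSup_natCast] using this

theorem le_essInf_iff {α β : Type*} [MeasurableSpace α] [CompleteLinearOrder β]
    [TopologicalSpace β] [FirstCountableTopology β] [OrderTopology β] {ν : Measure α}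
    {f : α → β} {c : β} : c ≤ essInf f ν ↔ ∀ᵐ a ∂ν, c ≤ f a :=
  ⟨fun h => (ae_essInf_le (f := f)).mono fun _ ha => h.trans ha,
    fun h => le_essInf_of_ae_le c h⟩

theorem essSup_le_iff {α β : Type*} [MeasurableSpace α] [CompleteLinearOrder β]
    [TopologicalSpace β] [FirstCountableTopology β] [OrderTopology β] {ν : Measure α}
    {f : α → β} {c : β} : essSup f ν ≤ c ↔ ∀ᵐ a ∂ν, f a ≤ c :=
  ⟨fun h => (ae_le_essSup (f := f)).mono fun _ ha => ha.trans h,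
    fun h => essSup_le_of_ae_le c h⟩

theorem essSup_neg_ereal {α : Type*} [MeasurableSpace α] {ν : Measure α} (f : α → EReal) :
    essSup (fun a => -f a) ν = -essInf f ν := by
  refine eq_of_forall_ge_iff fun c => ?_
  rw [essSup_le_iff, EReal.neg_le, le_essInf_iff]
  simp_rw [EReal.neg_le]

/-- Adding a real number has an order adjoint, `c ≤ e + y ↔ (c - e)⁺ ≤ y`, so every lower bound
passes through the essential infimum, infinite values included. -/
theorem essInf_coe_add {α : Type*} [MeasurableSpace α] {ν : Measure α} (e : ℝ)
    (h : α → ℝ≥0∞) :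
    essInf (fun a => (e : EReal) + (h a : EReal)) ν = (e : EReal) + (essInf h ν : ℝ≥0∞) := by
  refine eq_of_forall_le_iff fun c => ?_
  have key : ∀ y : ℝ≥0∞, c ≤ (e : EReal) + (y : EReal) ↔ (c - e).toENNReal ≤ y := by
    intro y
    rw [add_comm, ← EReal.sub_le_iff_le_add (by simp) (by simp)]
    constructor
    · intro hc
      have := EReal.toENNReal_le_toENNReal hc
      rwa [EReal.toENNReal_coe] at this
    · intro hc
      refine le_trans (le_max_right 0 _) ?_
      rw [← EReal.coe_toENNReal_eq_max]
      exact_mod_cast hc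
  rw [le_essInf_iff, key, le_essInf_iff]
  simp_rw [key]

theorem measurable_essInf_kernel {α β : Type*} [MeasurableSpace α] [MeasurableSpace β]
    (κ : Kernel α β) [IsFiniteKernel κ] {h : α × β → ℝ≥0∞} (hh : Measurable h) :
    Measurable fun x => essInf (fun z => h (x, z)) (κ x) := by
  refine measurable_of_Ici fun c => ?_
  have : (fun x => essInf (fun z => h (x, z)) (κ x)) ⁻¹' Set.Ici c
      = {x | κ x (Prod.mk x ⁻¹' {p | h p < c}) = 0} := by
    ext x
    simp only [Set.mem_preimage, Set.mem_Ici, le_essInf_iff, ae_iff, not_le, Set.mem_ofPred_eq]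
    rfl
  rw [this]
  exact (Kernel.measurable_kernel_prodMk_left (measurableSet_lt hh measurable_const))
    (measurableSet_singleton 0)

/-! ### Conditional means of nonnegative random variables -/

section CondLMean

variable {Ω 𝒲 : Type*} [MeasurableSpace Ω] [MeasurableSpace 𝒲]

/-- The conditional mean of a `[0, ∞]`-valued random variable `D` given `W = w`. -/
noncomputable def condLMean (μ : Measure Ω) [IsFiniteMeasure μ] (D : Ω → ℝ≥0∞) (W : Ω → 𝒲)
    (w : 𝒲) : ℝ≥0∞ :=
  ∫⁻ d, d ∂condDistrib D W μ w

variable {μ : Measure Ω} [IsFiniteMeasure μ] {D : Ω → ℝ≥0∞} {W : Ω → 𝒲}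

theorem measurable_condLMean : Measurable (condLMean μ D W) :=
  Measurable.lintegral_kernel measurable_id

theorem lintegral_mul_comp (hD : Measurable D) (hW : Measurable W) {c : 𝒲 → ℝ≥0∞}
    (hc : Measurable c) {φ : ℝ≥0∞ → ℝ≥0∞} (hφ : Measurable φ) :
    ∫⁻ ω, c (W ω) * φ (D ω) ∂μ
      = ∫⁻ w, c w * ∫⁻ d, φ d ∂condDistrib D W μ w ∂(μ.map W) := by
  have hm : Measurable fun p : 𝒲 × ℝ≥0∞ => c p.1 * φ p.2 := by fun_prop
  rw [← lintegral_map (f := fun p : 𝒲 × ℝ≥0∞ => c p.1 * φ p.2) hm (hW.prodMk hD),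
    ← compProd_map_condDistrib hD.aemeasurable, Measure.lintegral_compProd hm]
  refine lintegral_congr fun w => ?_
  exact lintegral_const_mul (c w) hφ

/-- Every conditional mean below that of `D` is the conditional mean of some `D' ≤ D`. -/
theorem exists_le_setLIntegral_eq (hD : Measurable D) (hW : Measurable W) {r : 𝒲 → ℝ≥0∞}
    (hr : Measurable r) (hle : ∀ᵐ w ∂(μ.map W), r w ≤ condLMean μ D W w) :
    ∃ D' : Ω → ℝ≥0∞, Measurable D' ∧ (∀ ω, D' ω ≤ D ω) ∧ (∀ ω, r (W ω) = 0 → D' ω = 0) ∧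
      ∀ A, MeasurableSet A → ∫⁻ ω in W ⁻¹' A, D' ω ∂μ = ∫⁻ w in A, r w ∂(μ.map W) := by
  -- Rescaling `D` by `r / E[D | W]` fails where `E[D | W] = ∞`. Instead `D` is cut into the layers
  -- `min D (n+1) - min D n`, whose conditional means are finite, and each layer is rescaled
  -- separately.
  set κ := condDistrib D W μ with hκ
  set g : ℕ → 𝒲 → ℝ≥0∞ := fun n w => ∫⁻ d, min d n ∂κ w with hg
  have hgm : ∀ n, Measurable (g n) := fun n =>
    Measurable.lintegral_kernel (measurable_id.min measurable_const)
  have hmono : ∀ d : ℝ≥0∞, Monotone fun n : ℕ => min d (n : ℝ≥0∞) := fun d a b hab =>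
    min_le_min le_rfl (by exact_mod_cast hab)
  have hgmono : ∀ w, Monotone fun n => g n w := fun w a b hab =>
    lintegral_mono fun d => hmono d hab
  have hgtop : ∀ n w, g n w ≠ ⊤ := by
    intro n w
    refine ne_top_of_le_ne_top (b := ∫⁻ _, (n : ℝ≥0∞) ∂κ w) ?_
      (lintegral_mono fun d => min_le_right _ _)
    simp
  have hgsup : ∀ w, ⨆ n, g n w = condLMean μ D W w := by
    intro w
    rw [condLMean, ← lintegral_iSup (f := fun (n : ℕ) (d : ℝ≥0∞) => min d (n : ℝ≥0∞))
      (fun n => measurable_id.min measurable_const) (fun a b hab d => hmono d hab)]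
    exact lintegral_congr fun d => iSup_min_natCast d
  set m : ℕ → 𝒲 → ℝ≥0∞ := fun n w => min (r w) (g n w) with hm
  have hmm : ∀ n, Measurable (m n) := fun n => hr.min (hgm n)
  -- The share of layer `n` that is kept, chosen so that the first `n` layers together have
  -- conditional mean `min r (g n)`. A layer of mean zero has numerator zero too, and `0 / 0 = 0`.
  set c : ℕ → 𝒲 → ℝ≥0∞ := fun n w => (m (n + 1) w - m n w) / (g (n + 1) w - g n w) with hc
  have hcm : ∀ n, Measurable (c n) := fun n =>
    ((hmm _).sub (hmm _)).div ((hgm _).sub (hgm _))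
  have hmg : ∀ n w, m (n + 1) w - m n w ≤ g (n + 1) w - g n w := by
    intro n w
    have h1 := hgmono w n.le_succ
    simp only [hm]
    rcases le_total (r w) (g n w) with h | h
    · rw [min_eq_left h, min_eq_left (h.trans h1)]; simp
    · rw [min_eq_right h]; exact tsub_le_tsub_right (min_le_right _ _) _
  have hc1 : ∀ n w, c n w ≤ 1 := fun n w => ENNReal.div_le_of_le_mul (by simpa using hmg n w)
  have hcg : ∀ n w, c n w * (g (n + 1) w - g n w) = m (n + 1) w - m n w := by
    intro n w
    refine ENNReal.div_mul_cancel' (fun h => ?_) (fun h => ?_)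
    · have := hmg n w
      rw [h] at this
      exact le_antisymm this bot_le
    · exact absurd h (ENNReal.sub_ne_top (hgtop _ _))
  set φ : ℕ → ℝ≥0∞ → ℝ≥0∞ := fun n d => min d (n + 1 : ℕ) - min d n with hφ
  have hφm : ∀ n, Measurable (φ n) := fun n =>
    (measurable_id.min measurable_const).sub (measurable_id.min measurable_const)
  have hφg : ∀ n w, ∫⁻ d, φ n d ∂κ w = g (n + 1) w - g n w := by
    intro n w
    exact lintegral_sub (measurable_id.min measurable_const) (hgtop n w)
      (ae_of_all _ fun d => hmono d n.le_succ)
  refine ⟨fun ω => ∑' n, c n (W ω) * φ n (D ω), ?_, ?_, ?_, ?_⟩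
  · exact Measurable.tsum fun n => ((hcm n).comp hW).mul ((hφm n).comp hD)
  · intro ω
    calc ∑' n, c n (W ω) * φ n (D ω) ≤ ∑' n, φ n (D ω) :=
          ENNReal.tsum_le_tsum fun n => mul_le_of_le_one_left bot_le (hc1 _ _)
      _ = D ω := by
          rw [← iSup_min_natCast (D ω)]
          simp only [hφ, iSup_min_natCast]
          rw [tsum_tsub_eq_iSup (u := fun n : ℕ => min (D ω) n) (hmono _) (by simp),
            iSup_min_natCast]
  · intro ω h
    simp [hc, hm, h]
  · intro A hA
    have hterm : ∀ n, ∫⁻ ω in W ⁻¹' A, c n (W ω) * φ n (D ω) ∂μ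
        = ∫⁻ w in A, (m (n + 1) w - m n w) ∂(μ.map W) := by
      intro n
      have h1 := lintegral_mul_comp (μ := μ) hD hW ((hcm n).indicator hA) (hφm n)
      rw [← lintegral_indicator (hW hA), ← lintegral_indicator hA]
      convert h1 using 1
      · refine lintegral_congr fun ω => ?_
        by_cases h : W ω ∈ A <;> simp [Set.indicator, h]
      · refine lintegral_congr fun w => ?_
        rw [hφg]
        by_cases h : w ∈ A
        · simp [Set.indicator, h, hcg]
        · simp [Set.indicator, h]
    rw [lintegral_tsum (f := fun n ω => c n (W ω) * φ n (D ω))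
      fun n => (((hcm n).comp hW).mul ((hφm n).comp hD)).aemeasurable]
    simp_rw [hterm]
    rw [← lintegral_tsum (f := fun n w => m (n + 1) w - m n w)
      fun n => ((hmm _).sub (hmm _)).aemeasurable]
    refine lintegral_congr_ae (ae_restrict_of_ae ?_)
    filter_upwards [hle] with w hw
    -- The increments of `m` telescope to `sup_n min r (g n) = min r E[D | W]`, which is `r`.
    rw [tsum_tsub_eq_iSup (u := fun n => m n w) (fun a b hab => min_le_min le_rfl (hgmono w hab))
      (by simp [hm, hg])]
    have : ⨆ n, r w ⊓ g n w = r w ⊓ ⨆ n, g n w := (inf_iSup_eq _ _).symm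
    rw [hgsup, inf_eq_left.2 hw] at this
    exact this

/-- The real form of `exists_le_setLIntegral_eq`. -/
theorem exists_le_condExp_eq (hD : Measurable D) (hW : Measurable W) {r : 𝒲 → ℝ≥0∞}
    (hr : Measurable r) (hle : ∀ᵐ w ∂(μ.map W), r w ≤ condLMean μ D W w)
    (hfin : ∫⁻ w, r w ∂(μ.map W) ≠ ⊤) :
    ∃ a : Ω → ℝ, Measurable a ∧ (∀ ω, 0 ≤ a ω) ∧ (∀ ω, ENNReal.ofReal (a ω) ≤ D ω) ∧
      (∀ ω, r (W ω) = 0 → a ω = 0) ∧ Integrable a μ ∧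
      μ[a | MeasurableSpace.comap W inferInstance] =ᵐ[μ] fun ω => (r (W ω)).toReal := by
  obtain ⟨D', hD'm, hD'le, hD'0, hD'int⟩ := exists_le_setLIntegral_eq hD hW hr hle
  have hD'fin : ∫⁻ ω, D' ω ∂μ ≠ ⊤ := by
    have := hD'int Set.univ MeasurableSet.univ
    simp only [Set.preimage_univ, Measure.restrict_univ] at this
    rwa [this]
  have hrfin : ∫⁻ ω, r (W ω) ∂μ ≠ ⊤ := by rwa [← lintegral_map hr hW]
  have hint : Integrable (fun ω => (D' ω).toReal) μ :=
    integrable_toReal_of_lintegral_ne_top hD'm.aemeasurable hD'fin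
  refine ⟨fun ω => (D' ω).toReal, hD'm.ennreal_toReal, fun ω => ENNReal.toReal_nonneg,
    fun ω => ENNReal.ofReal_toReal_le.trans (hD'le ω), fun ω h => by simp [hD'0 ω h], hint, ?_⟩
  refine (ae_eq_condExp_of_forall_setIntegral_eq hW.comap_le hint ?_ ?_ ?_).symm
  · intro s _ _
    exact (integrable_toReal_of_lintegral_ne_top (hr.comp hW).aemeasurable hrfin).integrableOn
  · rintro _ ⟨A, hA, rfl⟩ _
    rw [integral_toReal (f := fun ω => r (W ω)) (hr.comp hW).aemeasurable
        (ae_restrict_of_ae (ae_lt_top (hr.comp hW) hrfin)),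
      integral_toReal hD'm.aemeasurable (ae_restrict_of_ae (ae_lt_top hD'm hD'fin)), hD'int A hA,
      setLIntegral_map hA hr hW]
  · exact (hr.ennreal_toReal.comp (Measurable.of_comap_le le_rfl)).stronglyMeasurable.aestronglyMeasurable

end CondLMean

/-- A nonnegative function can be lowered to have any smaller integral. -/
theorem exists_le_lintegral_eq {α : Type*} [MeasurableSpace α] {ν : Measure α}
    [IsFiniteMeasure ν] {G : α → ℝ≥0∞} (hG : Measurable G) {t : ℝ≥0∞}
    (ht : t ≤ ∫⁻ x, G x ∂ν) :
    ∃ ρ : α → ℝ≥0∞, Measurable ρ ∧ (∀ x, ρ x ≤ G x) ∧ ∫⁻ x, ρ x ∂ν = t := by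
  rcases ht.eq_or_lt with rfl | hlt
  · exact ⟨G, hG, fun _ => le_rfl, rfl⟩
  -- The integral of `G` may be infinite, so a truncation whose finite integral still exceeds `t` is
  -- scaled down in place of `G`.
  have hsup : ⨆ n : ℕ, ∫⁻ x, min (G x) n ∂ν = ∫⁻ x, G x ∂ν := by
    rw [← lintegral_iSup (f := fun (n : ℕ) x => min (G x) (n : ℝ≥0∞))
      (fun n => hG.min measurable_const)
      (fun a b hab x => min_le_min le_rfl (by exact_mod_cast hab))]
    exact lintegral_congr fun x => iSup_min_natCast _
  rw [← hsup, lt_iSup_iff] at hlt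
  obtain ⟨n, hn⟩ := hlt
  have hfin : ∫⁻ x, min (G x) n ∂ν ≠ ⊤ := by
    refine ne_top_of_le_ne_top (b := ∫⁻ _, (n : ℝ≥0∞) ∂ν) ?_
      (lintegral_mono fun d => min_le_right _ _)
    simp [ENNReal.mul_eq_top]
  refine ⟨fun x => t / (∫⁻ x, min (G x) n ∂ν) * min (G x) n,
    (hG.min measurable_const).const_mul _, fun x => ?_, ?_⟩
  · exact (mul_le_of_le_one_left bot_le (ENNReal.div_le_of_le_mul (by simpa using hn.le))).trans
      (min_le_left _ _)
  · rw [lintegral_const_mul _ (hG.min measurable_const)]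
    exact ENNReal.div_mul_cancel (bot_le.trans_lt hn).ne' hfin

end WelfareGain

namespace WelfareGain

open scoped ENNReal

/-! ### Extended means -/

theorem emean_neg {Ω : Type*} [MeasurableSpace Ω] {ν : Measure Ω} {f : Ω → EReal}
    (hf : HasMean ν f) : emean ν (fun ω => -f ω) = -emean ν f := by
  unfold emean
  simp only [neg_neg]
  rw [EReal.neg_sub]
  · rw [add_comm, sub_eq_add_neg]
  · simp
  · rcases hf with h | h
    · left; simpa using h
    · right; simpa using h

theorem HasMean.neg {Ω : Type*} [MeasurableSpace Ω] {ν : Measure Ω} {f : Ω → EReal}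
    (hf : HasMean ν f) : HasMean ν (fun ω => -f ω) := by
  unfold HasMean at *
  simpa [or_comm] using hf

theorem lintegral_toENNReal_congr_ae {Ω : Type*} [MeasurableSpace Ω] {ν : Measure Ω}
    {f g : Ω → EReal} (h : f =ᵐ[ν] g) :
    ∫⁻ ω, (f ω).toENNReal ∂ν = ∫⁻ ω, (g ω).toENNReal ∂ν ∧
      ∫⁻ ω, (-f ω).toENNReal ∂ν = ∫⁻ ω, (-g ω).toENNReal ∂ν :=
  ⟨lintegral_congr_ae (h.mono fun ω hω => by simp only [hω]),
    lintegral_congr_ae (h.mono fun ω hω => by simp only [hω])⟩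

theorem emean_congr_ae {Ω : Type*} [MeasurableSpace Ω] {ν : Measure Ω} {f g : Ω → EReal}
    (h : f =ᵐ[ν] g) : emean ν f = emean ν g := by
  rw [emean, emean, (lintegral_toENNReal_congr_ae h).1, (lintegral_toENNReal_congr_ae h).2]

theorem HasMean.congr_ae {Ω : Type*} [MeasurableSpace Ω] {ν : Measure Ω} {f g : Ω → EReal}
    (hf : HasMean ν f) (h : f =ᵐ[ν] g) : HasMean ν g := by
  rwa [HasMean, (lintegral_toENNReal_congr_ae h).1, (lintegral_toENNReal_congr_ae h).2] at hf

/-- `(y + d)⁺ + y⁻ = (y + d)⁻ + y⁺ + d` is the decomposition into positive and negative parts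
written without subtraction. It survives `d = ∞` and can be integrated term by term. -/
theorem toENNReal_coe_add_balance (y : ℝ) (d : ℝ≥0∞) :
    ((y : EReal) + (d : EReal)).toENNReal + ENNReal.ofReal (-y)
      = (-((y : EReal) + (d : EReal))).toENNReal + ENNReal.ofReal y + d := by
  induction d with
  | top => simp
  | coe d =>
    have h : ((y : EReal) + ((d : ℝ≥0∞) : EReal)) = ((y + d : ℝ) : EReal) := by
      rw [EReal.coe_add]; rfl
    rw [h, ← EReal.coe_neg, EReal.real_coe_toENNReal, EReal.real_coe_toENNReal,
      ← ENNReal.ofReal_coe_nnreal]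
    have hd : (0 : ℝ) ≤ d := d.2
    rcases le_total 0 y with hy | hy
    · rw [ENNReal.ofReal_of_nonpos (neg_nonpos.2 hy),
        ENNReal.ofReal_of_nonpos (neg_nonpos.2 (by positivity)), ENNReal.ofReal_add hy hd]
      simp
    · rw [ENNReal.ofReal_of_nonpos hy, add_zero]
      rcases le_total 0 (y + d) with h1 | h1
      · rw [ENNReal.ofReal_of_nonpos (neg_nonpos.2 h1), zero_add,
          ← ENNReal.ofReal_add h1 (neg_nonneg.2 hy)]
        congr 1; ring
      · rw [ENNReal.ofReal_of_nonpos h1, zero_add,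
          ← ENNReal.ofReal_add (neg_nonneg.2 h1) hd]
        congr 1; ring

theorem emean_coe_add {Ω : Type*} [MeasurableSpace Ω] {ν : Measure Ω} {f : Ω → ℝ}
    (hfm : Measurable f) (hf : Integrable f ν) {D : Ω → ℝ≥0∞} (hD : Measurable D) :
    HasMean ν (fun ω => (f ω : EReal) + (D ω : EReal)) ∧
      emean ν (fun ω => (f ω : EReal) + (D ω : EReal))
        = ((∫ ω, f ω ∂ν : ℝ) : EReal) + ((∫⁻ ω, D ω ∂ν : ℝ≥0∞) : EReal) := by
  have hsum : Measurable fun ω => (f ω : EReal) + (D ω : EReal) :=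
    hfm.coe_real_ereal.add hD.coe_ereal_ennreal
  have hp : ∫⁻ ω, ENNReal.ofReal (f ω) ∂ν ≠ ⊤ := hf.lintegral_lt_top.ne
  have hn : ∫⁻ ω, ENNReal.ofReal (-f ω) ∂ν ≠ ⊤ := hf.neg.lintegral_lt_top.ne
  -- The negative part of `f + D` is dominated by that of `f`, which rules out `∞ - ∞`.
  have hN : ∫⁻ ω, (-((f ω : EReal) + (D ω : EReal))).toENNReal ∂ν ≠ ⊤ := by
    refine ne_top_of_le_ne_top hn (lintegral_mono fun ω => ?_)
    have := EReal.toENNReal_le_toENNReal (x := -((f ω : EReal) + (D ω : EReal)))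
      (y := ((-f ω : ℝ) : EReal)) (by
        rw [EReal.coe_neg, EReal.neg_le_neg_iff]
        exact le_add_of_nonneg_right (EReal.coe_ennreal_nonneg _))
    simpa using this
  have hbal : ∫⁻ ω, ((f ω : EReal) + (D ω : EReal)).toENNReal ∂ν
        + ∫⁻ ω, ENNReal.ofReal (-f ω) ∂ν
      = ∫⁻ ω, (-((f ω : EReal) + (D ω : EReal))).toENNReal ∂ν
        + ∫⁻ ω, ENNReal.ofReal (f ω) ∂ν + ∫⁻ ω, D ω ∂ν := by
    have hm1 : Measurable fun ω => (-((f ω : EReal) + (D ω : EReal))).toENNReal :=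
      hsum.neg.ereal_toENNReal
    rw [← lintegral_add_left hsum.ereal_toENNReal, ← lintegral_add_left hm1,
      ← lintegral_add_right _ hD]
    exact lintegral_congr fun ω => toENNReal_coe_add_balance _ _
  refine ⟨Or.inr hN, ?_⟩
  unfold emean
  rw [integral_eq_lintegral_pos_part_sub_lintegral_neg_part hf]
  generalize ∫⁻ ω, ((f ω : EReal) + (D ω : EReal)).toENNReal ∂ν = P at *
  generalize ∫⁻ ω, (-((f ω : EReal) + (D ω : EReal))).toENNReal ∂ν = N at *
  generalize ∫⁻ ω, ENNReal.ofReal (f ω) ∂ν = p at *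
  generalize ∫⁻ ω, ENNReal.ofReal (-f ω) ∂ν = n at *
  generalize ∫⁻ ω, D ω ∂ν = L at *
  lift N to NNReal using hN
  lift p to NNReal using hp
  lift n to NNReal using hn
  induction L with
  | top =>
    have : P = ⊤ := by
      simpa using hbal
    subst this
    simp only [ENNReal.coe_toReal, EReal.coe_ennreal_top, EReal.coe_add_top]
    exact EReal.top_sub_coe (N : ℝ)
  | coe L =>
    have hPtop : P ≠ ⊤ := by
      rintro rfl
      simp at hbal
      exact ENNReal.coe_ne_top hbal.symm
    lift P to NNReal using hPtop
    have hb : (P : ℝ) + n = N + p + L := by exact_mod_cast hbal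
    have : (((P : ℝ) - N : ℝ) : EReal) = (((p : ℝ) - n + L : ℝ) : EReal) := by
      congr 1; linarith
    rw [EReal.coe_sub, EReal.coe_add] at this
    exact this

theorem emean_map_id {α : Type*} [MeasurableSpace α] {ν : Measure α}
    {φ : α → EReal} (hφ : Measurable φ) :
    emean (ν.map φ) id = emean ν φ ∧ (HasMean (ν.map φ) id ↔ HasMean ν φ) := by
  unfold emean HasMean
  have h1 : ∫⁻ y, (id y : EReal).toENNReal ∂(ν.map φ) = ∫⁻ a, (φ a).toENNReal ∂ν :=
    lintegral_map measurable_ereal_toENNReal hφ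
  have h2 : ∫⁻ y, (-(id y : EReal)).toENNReal ∂(ν.map φ) = ∫⁻ a, (-φ a).toENNReal ∂ν :=
    lintegral_map (f := fun y : EReal => (-y).toENNReal) measurable_id.neg.ereal_toENNReal hφ
  rw [h1, h2]
  exact ⟨rfl, Iff.rfl⟩

/-! ### Conditional means of random variables with an integrable minorant -/

/-- The excess of `S` over the real function `f`. -/
noncomputable def excess {Ω : Type*} (f : Ω → ℝ) (S : Ω → EReal) (ω : Ω) : ℝ≥0∞ :=
  (S ω - (f ω : EReal)).toENNReal

theorem coe_add_excess {Ω : Type*} {f : Ω → ℝ} {S : Ω → EReal} {ω : Ω} (h : (f ω : EReal) ≤ S ω) :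
    (f ω : EReal) + (excess f S ω : EReal) = S ω := by
  rw [excess, EReal.coe_toENNReal (EReal.sub_nonneg (by simp) (by simp) |>.2 h), add_comm,
    EReal.sub_add_cancel]

section CondMean

variable {Ω 𝒲 𝒳 𝓏 : Type*} [MeasurableSpace Ω] [MeasurableSpace 𝒲] [MeasurableSpace 𝒳]
  [MeasurableSpace 𝓏] {μ : Measure Ω} [IsFiniteMeasure μ] {f : Ω → ℝ} {S : Ω → EReal}

theorem measurable_excess (hf : Measurable f) (hS : Measurable S) : Measurable (excess f S) := by
  unfold excess
  simp_rw [sub_eq_add_neg]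
  exact (hS.add hf.coe_real_ereal.neg).ereal_toENNReal

/-- The conditional law of `S` is the image under addition of the joint conditional law of `f` and
its excess. Applying `emean_coe_add` to that joint law splits the mean into its two marginal means.
-/
theorem condMean_ae_eq (hfm : Measurable f) (hf : Integrable f μ) (hS : Measurable S)
    (hle : ∀ᵐ ω ∂μ, (f ω : EReal) ≤ S ω) {W : Ω → 𝒲} (hW : Measurable W) :
    ∀ᵐ w ∂(μ.map W), HasMean (condDistrib S W μ w) id ∧
      condMean μ S W w = ((∫ y, y ∂condDistrib f W μ w : ℝ) : EReal)
        + (condLMean μ (excess f S) W w : EReal) := by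
  have hD := measurable_excess hfm hS
  have hpair : Measurable fun ω => (f ω, excess f S ω) := hfm.prodMk hD
  have hφ : Measurable fun p : ℝ × ℝ≥0∞ => (p.1 : EReal) + (p.2 : EReal) :=
    measurable_fst.coe_real_ereal.add measurable_snd.coe_ereal_ennreal
  have hSeq : S =ᵐ[μ] (fun p : ℝ × ℝ≥0∞ => (p.1 : EReal) + (p.2 : EReal)) ∘
      fun ω => (f ω, excess f S ω) := by
    filter_upwards [hle] with ω hω
    exact (coe_add_excess hω).symm
  have h1 := condDistrib_comp (μ := μ) (mβ := ‹_›) W hpair.aemeasurable hφ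
  rw [← condDistrib_congr_left hSeq] at h1
  have h2 := condDistrib_comp (μ := μ) (mβ := ‹_›) W hpair.aemeasurable measurable_fst
  have h3 := condDistrib_comp (μ := μ) (mβ := ‹_›) W hpair.aemeasurable measurable_snd
  have h4 : ∀ᵐ w ∂(μ.map W), Integrable (fun y => y) (condDistrib f W μ w) := by
    refine Integrable.condDistrib_ae_map (f := fun p : 𝒲 × ℝ => p.2) hfm.aemeasurable ?_
    rwa [integrable_map_measure measurable_snd.aestronglyMeasurable
      (hW.prodMk hfm).aemeasurable]
  filter_upwards [h1, h2, h3, h4] with w h1 h2 h3 h4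
  rw [Kernel.map_apply _ hφ] at h1
  rw [Kernel.map_apply _ measurable_fst] at h2
  rw [Kernel.map_apply _ measurable_snd] at h3
  have h2' : condDistrib f W μ w
      = (condDistrib (fun ω => (f ω, excess f S ω)) W μ w).map Prod.fst := h2
  have h3' : condDistrib (excess f S) W μ w
      = (condDistrib (fun ω => (f ω, excess f S ω)) W μ w).map Prod.snd := h3
  rw [condMean, condLMean, h1, h2', h3', (emean_map_id hφ).1,
    (emean_map_id hφ).2, lintegral_map (f := fun d : ℝ≥0∞ => d) measurable_id measurable_snd,
    integral_map (f := fun y : ℝ => y) measurable_fst.aemeasurable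
      measurable_id.aestronglyMeasurable]
  refine emean_coe_add measurable_fst ?_ measurable_snd
  rw [h2'] at h4
  exact (integrable_map_measure measurable_id.aestronglyMeasurable
    measurable_fst.aemeasurable).1 h4

/-- The conditional mean of `f` given `X = x`. -/
noncomputable def regr (μ : Measure Ω) [IsFiniteMeasure μ] (f : Ω → ℝ) (X : Ω → 𝒳) (x : 𝒳) : ℝ :=
  ∫ y, y ∂condDistrib f X μ x

theorem measurable_regr {X : Ω → 𝒳} : Measurable (regr μ f X) :=
  (StronglyMeasurable.integral_condDistrib (f := fun p : 𝒳 × ℝ => p.2)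
    measurable_snd.stronglyMeasurable).measurable

theorem condExp_ae_eq_regr (hf : Integrable f μ) {X : Ω → 𝒳} (hX : Measurable X) :
    μ[f | MeasurableSpace.comap X inferInstance] =ᵐ[μ] fun ω => regr μ f X (X ω) :=
  condExp_ae_eq_integral_condDistrib' hX hf

theorem regr_prod_ae_eq (hf : Integrable f μ) {X : Ω → 𝒳} (hX : Measurable X) {Z : Ω → 𝓏}
    (hZ : Measurable Z)
    (hind : μ[f | MeasurableSpace.comap (fun ω => (X ω, Z ω)) inferInstance] =ᵐ[μ]
      μ[f | MeasurableSpace.comap X inferInstance]) :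
    ∀ᵐ p ∂(μ.map fun ω => (X ω, Z ω)), regr μ f (fun ω => (X ω, Z ω)) p = regr μ f X p.1 := by
  rw [ae_map_iff (hX.prodMk hZ).aemeasurable
    (measurableSet_eq_fun (g := fun p : 𝒳 × 𝓏 => regr μ f X p.1) measurable_regr
      (measurable_regr.comp measurable_fst))]
  filter_upwards [hind, condExp_ae_eq_regr hf hX, condExp_ae_eq_regr hf (hX.prodMk hZ)]
    with ω h1 h2 h3
  rw [← h3, h1, h2]

variable [StandardBorelSpace 𝓏] [Nonempty 𝓏]

/-- The essential infimum over `z` of the conditional means of `D` given `X = x` and `Z = z`. -/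
noncomputable def margin (μ : Measure Ω) [IsFiniteMeasure μ] (D : Ω → ℝ≥0∞) (X : Ω → 𝒳)
    (Z : Ω → 𝓏) (x : 𝒳) : ℝ≥0∞ :=
  essInf (fun z => condLMean μ D (fun ω => (X ω, Z ω)) (x, z)) (condDistrib Z X μ x)

theorem measurable_margin {D : Ω → ℝ≥0∞} {X : Ω → 𝒳} {Z : Ω → 𝓏} :
    Measurable (margin μ D X Z) :=
  measurable_essInf_kernel _ measurable_condLMean

/-- The essential infimum is a lower bound for almost every `z`, and the law of `(X, Z)`
disintegrates over that of `X`. A function of `x` below the margin is therefore an admissible target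
for `exists_le_condExp_eq`. -/
theorem margin_le_condLMean {D : Ω → ℝ≥0∞} {X : Ω → 𝒳} {Z : Ω → 𝓏} (hZ : Measurable Z) :
    ∀ᵐ p ∂(μ.map fun ω => (X ω, Z ω)),
      margin μ D X Z p.1 ≤ condLMean μ D (fun ω => (X ω, Z ω)) p := by
  rw [← compProd_map_condDistrib hZ.aemeasurable]
  rw [Measure.ae_compProd_iff
    (measurableSet_le (f := fun p : 𝒳 × 𝓏 => margin μ D X Z p.1)
      (measurable_margin.comp measurable_fst) measurable_condLMean)]
  exact ae_of_all _ fun x => le_essInf_iff.1 (le_refl (margin μ D X Z x))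

theorem ae_ae_of_ae_map_prod {X : Ω → 𝒳} {Z : Ω → 𝓏} (hZ : Measurable Z)
    {p : 𝒳 × 𝓏 → Prop} (h : ∀ᵐ w ∂(μ.map fun ω => (X ω, Z ω)), p w) :
    ∀ᵐ x ∂(μ.map X), ∀ᵐ z ∂condDistrib Z X μ x, p (x, z) := by
  rw [← compProd_map_condDistrib hZ.aemeasurable] at h
  exact Measure.ae_ae_of_ae_compProd h

/-- Mean independence makes the real part of the conditional mean constant in `z`, so it leaves the
essential infimum. -/
theorem essInf_condMean_ae_eq (hfm : Measurable f) (hf : Integrable f μ) (hS : Measurable S)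
    (hle : ∀ᵐ ω ∂μ, (f ω : EReal) ≤ S ω) {X : Ω → 𝒳} (hX : Measurable X) {Z : Ω → 𝓏}
    (hZ : Measurable Z)
    (hind : μ[f | MeasurableSpace.comap (fun ω => (X ω, Z ω)) inferInstance] =ᵐ[μ]
      μ[f | MeasurableSpace.comap X inferInstance]) :
    ∀ᵐ x ∂(μ.map X),
      essInf (fun z => condMean μ S (fun ω => (X ω, Z ω)) (x, z)) (condDistrib Z X μ x)
        = (regr μ f X x : EReal) + (margin μ (excess f S) X Z x : EReal) := by
  filter_upwards [ae_ae_of_ae_map_prod hZ (regr_prod_ae_eq hf hX hZ hind),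
    ae_ae_of_ae_map_prod hZ (condMean_ae_eq hfm hf hS hle (hX.prodMk hZ))] with x h1 h2
  rw [margin, ← essInf_coe_add]
  refine essInf_congr_ae ?_
  filter_upwards [h1, h2] with z h1 h2
  rw [h2.2]
  change ((regr μ f (fun ω => (X ω, Z ω)) (x, z) : ℝ) : EReal) + _ = _
  rw [h1]

/-- Moving a random variable up or down by amounts whose conditional means are prescribed functions
of `X` below the margins. -/
theorem exists_shift {D₁ D₂ : Ω → ℝ≥0∞} (hD₁ : Measurable D₁) (hD₂ : Measurable D₂)
    {X : Ω → 𝒳} (hX : Measurable X) {Z : Ω → 𝓏} (hZ : Measurable Z) {P Q : Set 𝒳}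
    (hP : MeasurableSet P) (hQ : MeasurableSet Q) (hPQ : Disjoint P Q) {ρ : 𝒳 → ℝ≥0∞}
    (hρ : Measurable ρ)
    (hle : ∀ x, ρ x ≤ P.indicator (margin μ D₁ X Z) x + Q.indicator (margin μ D₂ X Z) x)
    (hfin : ∫⁻ x, ρ x ∂(μ.map X) ≠ ⊤) :
    ∃ u : Ω → ℝ, Measurable u ∧ Integrable u μ ∧ (∀ ω, ENNReal.ofReal (-u ω) ≤ D₁ ω) ∧
      (∀ ω, ENNReal.ofReal (u ω) ≤ D₂ ω) ∧
      μ[u | MeasurableSpace.comap (fun ω => (X ω, Z ω)) inferInstance] =ᵐ[μ]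
        (fun ω => (Q.indicator ρ (X ω)).toReal - (P.indicator ρ (X ω)).toReal) ∧
      μ[u | MeasurableSpace.comap X inferInstance] =ᵐ[μ]
        (fun ω => (Q.indicator ρ (X ω)).toReal - (P.indicator ρ (X ω)).toReal) := by
  have key : ∀ (D : Ω → ℝ≥0∞) (R : Set 𝒳), Measurable D → MeasurableSet R →
      (∀ x ∈ R, ρ x ≤ margin μ D X Z x) →
      ∃ a : Ω → ℝ, Measurable a ∧ (∀ ω, 0 ≤ a ω) ∧ (∀ ω, ENNReal.ofReal (a ω) ≤ D ω) ∧
        (∀ ω, X ω ∉ R → a ω = 0) ∧ Integrable a μ ∧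
        μ[a | MeasurableSpace.comap (fun ω => (X ω, Z ω)) inferInstance] =ᵐ[μ]
          (fun ω => (R.indicator ρ (X ω)).toReal) ∧
        μ[a | MeasurableSpace.comap X inferInstance] =ᵐ[μ]
          (fun ω => (R.indicator ρ (X ω)).toReal) := by
    intro D R hD hR hRle
    have hρR : Measurable (R.indicator ρ) := hρ.indicator hR
    have hmap : (μ.map fun ω => (X ω, Z ω)).map Prod.fst = μ.map X :=
      Measure.map_map measurable_fst (hX.prodMk hZ)
    obtain ⟨a, h1, h2, h3, h4, h5, h6⟩ := exists_le_condExp_eq (μ := μ)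
      (r := fun p : 𝒳 × 𝓏 => R.indicator ρ p.1) hD (hX.prodMk hZ) (hρR.comp measurable_fst)
      (by
        filter_upwards [margin_le_condLMean (D := D) (X := X) hZ] with p hp
        by_cases h : p.1 ∈ R
        · simpa [Set.indicator, h] using (hRle _ h).trans hp
        · simp [Set.indicator, h])
      (by
        rw [← lintegral_map hρR measurable_fst, hmap]
        exact ne_top_of_le_ne_top hfin (lintegral_mono fun x => Set.indicator_le_self _ _ _))
    refine ⟨a, h1, h2, h3, fun ω hω => h4 ω (by simp [hω]), h5, h6, ?_⟩
    have hfin' : ∫⁻ ω, R.indicator ρ (X ω) ∂μ ≠ ⊤ := by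
      rw [← lintegral_map hρR hX]
      exact ne_top_of_le_ne_top hfin (lintegral_mono fun x => Set.indicator_le_self _ _ _)
    have hcomap : MeasurableSpace.comap X inferInstance
        ≤ MeasurableSpace.comap (fun ω => (X ω, Z ω)) inferInstance := by
      rintro _ ⟨A, hA, rfl⟩
      exact ⟨Prod.fst ⁻¹' A, measurable_fst hA, rfl⟩
    -- The conditional mean given `(X, Z)` is already a function of `X`, so by the tower property it
    -- is also the one given `X`.
    have h7 := condExp_condExp_of_le (μ := μ) (f := a) hcomap (hX.prodMk hZ).comap_le
    refine h7.symm.trans ((condExp_congr_ae h6).trans ?_)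
    refine (condExp_of_stronglyMeasurable hX.comap_le ?_ ?_).eventuallyEq
    · exact (hρR.ennreal_toReal.comp (Measurable.of_comap_le le_rfl)).stronglyMeasurable
    · exact integrable_toReal_of_lintegral_ne_top (hρR.comp hX).aemeasurable hfin'
  obtain ⟨a, ha1, ha2, ha3, ha4, ha5, ha6, ha7⟩ := key D₁ P hD₁ hP fun x hx => by
    simpa [hx, Set.disjoint_left.1 hPQ hx] using hle x
  obtain ⟨b, hb1, hb2, hb3, hb4, hb5, hb6, hb7⟩ := key D₂ Q hD₂ hQ fun x hx => by
    simpa [hx, Set.disjoint_right.1 hPQ hx] using hle x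
  -- Both parts are nonnegative, so `u ≤ b ≤ D₂` and `-u ≤ a ≤ D₁`.
  refine ⟨b - a, hb1.sub ha1, hb5.sub ha5, fun ω => ?_, fun ω => ?_, ?_, ?_⟩
  · refine le_trans (ENNReal.ofReal_le_ofReal ?_) (ha3 ω)
    have := hb2 ω
    simp only [Pi.sub_apply]; linarith
  · refine le_trans (ENNReal.ofReal_le_ofReal ?_) (hb3 ω)
    have := ha2 ω
    simp only [Pi.sub_apply]; linarith
  · filter_upwards [condExp_sub hb5 ha5
      (MeasurableSpace.comap (fun ω => (X ω, Z ω)) inferInstance), ha6, hb6] with ω h1 h2 h3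
    rw [h1, Pi.sub_apply, h2, h3]
  · filter_upwards [condExp_sub hb5 ha5 (MeasurableSpace.comap X inferInstance), ha7, hb7]
      with ω h1 h2 h3
    rw [h1, Pi.sub_apply, h2, h3]

end CondMean

end WelfareGain

namespace WelfareGain

open scoped ENNReal

/-! ### Support functions of random sets -/

theorem le_supportFun {v y : Plane} {K : Set Plane} (hy : y ∈ K) :
    ((inner ℝ v y : ℝ) : EReal) ≤ supportFun v K :=
  le_iSup₂ (f := fun (x : Plane) (_ : x ∈ K) => ((inner ℝ v x : ℝ) : EReal)) y hy

theorem measurable_supportFun {Ω : Type*} [MeasurableSpace Ω] {F : Ω → Set Plane}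
    (hF : IsRandomClosedSet F) (v : Plane) : Measurable fun ω => supportFun v (F ω) := by
  refine measurable_of_Ioi fun c => ?_
  -- The support function exceeds `c` exactly when the set hits, for some rational `q > c`, the
  -- half-space at level `q` inside some ball. These are compact sets, to which the hitting
  -- condition applies.
  have : (fun ω => supportFun v (F ω)) ⁻¹' Set.Ioi c
      = ⋃ (q : ℚ) (_ : c < ((q : ℝ) : EReal)) (n : ℕ),
        {ω | (F ω ∩ (Metric.closedBall 0 n ∩ {y | (q : ℝ) ≤ inner ℝ v y})).Nonempty} := by
    ext ω
    simp only [supportFun, Set.mem_preimage, Set.mem_Ioi, lt_iSup_iff, Set.mem_iUnion,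
      Set.mem_ofPred_eq, exists_prop]
    constructor
    · rintro ⟨y, hy, hc⟩
      obtain ⟨q, hq1, hq2⟩ := EReal.lt_iff_exists_rat_btwn.1 hc
      obtain ⟨n, hn⟩ := exists_nat_ge ‖y‖
      exact ⟨q, hq1, n, y, hy, by simpa using hn, by exact_mod_cast hq2.le⟩
    · rintro ⟨q, hq, n, y, hy, -, hy2⟩
      exact ⟨y, hy, hq.trans_le (by exact_mod_cast hy2)⟩
  rw [this]
  refine MeasurableSet.iUnion fun q => MeasurableSet.iUnion fun _ => MeasurableSet.iUnion fun n =>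
    hF.2 _ ((isCompact_closedBall _ _).inter_right ?_)
  exact isClosed_le continuous_const (continuous_const.inner continuous_id)

theorem inner_v₁ (y : Plane) : inner ℝ v₁ y = y 0 := by
  simp [v₁, PiLp.inner_apply, Fin.sum_univ_two]

theorem inner_v₀ (y : Plane) : inner ℝ v₀ y = y 1 := by
  simp [v₀, PiLp.inner_apply, Fin.sum_univ_two]

/-- If `y + t` were missing, convexity would put all of `K` strictly below it. The supremum of `K`
is then finite and attained by closedness, hence less than `y + t`, against the assumed room `t`
above `y`. -/
theorem add_mem_of_ofReal_le {K : Set ℝ} (hK : IsClosed K) (hconv : Convex ℝ K) {y t : ℝ}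
    (hy : y ∈ K) (ht : 0 ≤ t) {s : EReal} (hs : s ≤ ⨆ x ∈ K, (x : EReal))
    (hle : ENNReal.ofReal t ≤ (s - (y : EReal)).toENNReal) : y + t ∈ K := by
  by_contra hmem
  have hlt : ∀ x ∈ K, x < y + t := by
    intro x hx
    by_contra! h
    exact hmem (hconv.ordConnected.out hy hx ⟨by linarith, h⟩)
  have hbdd : BddAbove K := ⟨y + t, fun x hx => (hlt x hx).le⟩
  have hM := hK.csSup_mem ⟨y, hy⟩ hbdd
  have hsM : s ≤ (sSup K : ℝ) :=
    hs.trans (iSup₂_le fun x hx => by exact_mod_cast le_csSup hbdd hx)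
  have h1 : (s - (y : EReal)).toENNReal ≤ ENNReal.ofReal (sSup K - y) := by
    rw [← EReal.real_coe_toENNReal, EReal.coe_sub]
    exact EReal.toENNReal_le_toENNReal (EReal.sub_le_sub hsM le_rfl)
  have h2 := (ENNReal.ofReal_le_ofReal_iff (sub_nonneg.2 (le_csSup hbdd hy))).1 (hle.trans h1)
  linarith [hlt _ hM]

theorem add_mem_of_ofReal_le_of_ofReal_neg_le {K : Set ℝ} (hK : IsClosed K) (hconv : Convex ℝ K)
    {y u : ℝ} (hy : y ∈ K) {s s' : EReal} (hs : s ≤ ⨆ x ∈ K, (x : EReal))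
    (hs' : s' ≤ ⨆ x ∈ K, ((-x : ℝ) : EReal))
    (hle : ENNReal.ofReal u ≤ (s - (y : EReal)).toENNReal)
    (hle' : ENNReal.ofReal (-u) ≤ (s' - ((-y : ℝ) : EReal)).toENNReal) : y + u ∈ K := by
  rcases le_total 0 u with hu | hu
  · exact add_mem_of_ofReal_le hK hconv hy hu hs hle
  · have := add_mem_of_ofReal_le (K := -K) hK.neg hconv.neg (y := -y) (t := -u) (by simpa)
      (by linarith) (hs'.trans (iSup₂_le fun x hx => le_iSup₂ (f := fun (x : ℝ) (_ : x ∈ -K) =>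
        (x : EReal)) (-x) (by simpa))) hle'
    have h2 := Set.mem_neg.1 this
    convert h2 using 1
    ring

/-- A pair in a closed convex product set can be moved in each coordinate up to the support
functions. -/
theorem add_mem_prodSet {Ω : Type*} {𝒴₁ 𝒴₀ : Ω → Set ℝ} {ω : Ω}
    (hcl : IsClosed (prodSet 𝒴₁ 𝒴₀ ω)) (hconv : Convex ℝ (prodSet 𝒴₁ 𝒴₀ ω)) {y : Plane}
    (hy : y ∈ prodSet 𝒴₁ 𝒴₀ ω) {u₁ u₀ : ℝ}
    (h₁ : ENNReal.ofReal u₁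
      ≤ (supportFun v₁ (prodSet 𝒴₁ 𝒴₀ ω) - (inner ℝ v₁ y : ℝ)).toENNReal)
    (h₁' : ENNReal.ofReal (-u₁)
      ≤ (supportFun (-v₁) (prodSet 𝒴₁ 𝒴₀ ω) - (inner ℝ (-v₁) y : ℝ)).toENNReal)
    (h₀ : ENNReal.ofReal u₀
      ≤ (supportFun v₀ (prodSet 𝒴₁ 𝒴₀ ω) - (inner ℝ v₀ y : ℝ)).toENNReal)
    (h₀' : ENNReal.ofReal (-u₀)
      ≤ (supportFun (-v₀) (prodSet 𝒴₁ 𝒴₀ ω) - (inner ℝ (-v₀) y : ℝ)).toENNReal) :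
    y + (u₁ • v₁ + u₀ • v₀) ∈ prodSet 𝒴₁ 𝒴₀ ω := by
  rw [inner_neg_left, inner_v₁] at h₁'
  rw [inner_neg_left, inner_v₀] at h₀'
  rw [inner_v₁] at h₁
  rw [inner_v₀] at h₀
  -- Each factor is the slice of the product through `y`, and so inherits closedness and convexity.
  have hcl₁ : IsClosed (𝒴₁ ω) := by
    have : 𝒴₁ ω = (fun s : ℝ => (!₂[s, y 1] : Plane)) ⁻¹' prodSet 𝒴₁ 𝒴₀ ω := by
      ext s; simp [prodSet, hy.2]
    rw [this]
    exact hcl.preimage (by fun_prop)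
  have hcl₀ : IsClosed (𝒴₀ ω) := by
    have : 𝒴₀ ω = (fun s : ℝ => (!₂[y 0, s] : Plane)) ⁻¹' prodSet 𝒴₁ 𝒴₀ ω := by
      ext s; simp [prodSet, hy.1]
    rw [this]
    exact hcl.preimage (by fun_prop)
  have hco₁ : Convex ℝ (𝒴₁ ω) := by
    intro a ha b hb p q hp hq hpq
    have := (hconv (x := (!₂[a, y 1] : Plane)) ⟨ha, hy.2⟩ (y := (!₂[b, y 1] : Plane))
      ⟨hb, hy.2⟩ hp hq hpq).1
    simpa using this
  have hco₀ : Convex ℝ (𝒴₀ ω) := by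
    intro a ha b hb p q hp hq hpq
    have := (hconv (x := (!₂[y 0, a] : Plane)) ⟨hy.1, ha⟩ (y := (!₂[y 0, b] : Plane))
      ⟨hy.1, hb⟩ hp hq hpq).2
    simpa using this
  constructor
  · have := add_mem_of_ofReal_le_of_ofReal_neg_le hcl₁ hco₁ hy.1 (iSup₂_le fun x hx => ?_)
      (iSup₂_le fun x hx => ?_) h₁ h₁'
    · simpa [v₁, v₀] using this
    · rw [inner_v₁]
      exact le_iSup₂ (f := fun (s : ℝ) (_ : s ∈ 𝒴₁ ω) => (s : EReal)) (x 0) hx.1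
    · rw [inner_neg_left, inner_v₁]
      exact le_iSup₂ (f := fun (s : ℝ) (_ : s ∈ 𝒴₁ ω) => ((-s : ℝ) : EReal)) (x 0) hx.1
  · have := add_mem_of_ofReal_le_of_ofReal_neg_le hcl₀ hco₀ hy.2 (iSup₂_le fun x hx => ?_)
      (iSup₂_le fun x hx => ?_) h₀ h₀'
    · simpa [v₁, v₀] using this
    · rw [inner_v₀]
      exact le_iSup₂ (f := fun (s : ℝ) (_ : s ∈ 𝒴₀ ω) => (s : EReal)) (x 1) hx.2
    · rw [inner_neg_left, inner_v₀]
      exact le_iSup₂ (f := fun (s : ℝ) (_ : s ∈ 𝒴₀ ω) => ((-s : ℝ) : EReal)) (x 1) hx.2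

/-! ### The instrumental bounds around an admissible pair -/

section Bounds

variable {Ω 𝒳 : Type*} [MeasurableSpace Ω] [MeasurableSpace 𝒳] {dz : ℕ} {μ : Measure Ω}
  {F : Ω → Set Plane} {X : Ω → 𝒳} {Z : Ω → EuclideanSpace ℝ (Fin dz)}
  {Y : Ω → Plane}

/-- How far the support function of `F` in direction `v` exceeds the value at `Y`. -/
noncomputable def slack (F : Ω → Set Plane) (Y : Ω → Plane) (v : Plane) : Ω → ℝ≥0∞ :=
  excess (fun ω => inner ℝ v (Y ω)) fun ω => supportFun v (F ω)

theorem IsAdmissible.measurable_inner (hY : IsAdmissible F μ X Z Y) (v : Plane) :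
    Measurable fun ω => (inner ℝ v (Y ω) : ℝ) :=
  measurable_const.inner hY.1.1

theorem IsAdmissible.integrable_inner (hY : IsAdmissible F μ X Z Y) (v : Plane) :
    Integrable (fun ω => (inner ℝ v (Y ω) : ℝ)) μ :=
  hY.2.1.const_inner v

theorem IsAdmissible.integrable_fst (hY : IsAdmissible F μ X Z Y) :
    Integrable (fun ω => Y ω 0) μ := by
  simpa only [inner_v₁] using hY.integrable_inner v₁

theorem IsAdmissible.integrable_snd (hY : IsAdmissible F μ X Z Y) :
    Integrable (fun ω => Y ω 1) μ := by
  simpa only [inner_v₀] using hY.integrable_inner v₀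

theorem IsAdmissible.inner_le_supportFun (hY : IsAdmissible F μ X Z Y) (v : Plane) :
    ∀ᵐ ω ∂μ, ((inner ℝ v (Y ω) : ℝ) : EReal) ≤ supportFun v (F ω) :=
  hY.1.2.mono fun _ h => le_supportFun h

theorem IsAdmissible.measurable_slack (hF : IsRandomClosedSet F) (hY : IsAdmissible F μ X Z Y)
    (v : Plane) : Measurable (slack F Y v) :=
  measurable_excess (hY.measurable_inner v) (measurable_supportFun hF v)

theorem IsAdmissible.condExp_inner (hY : IsAdmissible F μ X Z Y) (v : Plane) :
    μ[fun ω => (inner ℝ v (Y ω) : ℝ) |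
        MeasurableSpace.comap (fun ω => (X ω, Z ω)) inferInstance] =ᵐ[μ]
      μ[fun ω => (inner ℝ v (Y ω) : ℝ) | MeasurableSpace.comap X inferInstance] := by
  have h : (fun ω => (inner ℝ v (Y ω) : ℝ))
      = v 0 • (fun ω => Y ω 0) + v 1 • (fun ω => Y ω 1) := by
    ext ω
    simp [PiLp.inner_apply, Fin.sum_univ_two, mul_comm]
  have h0 := hY.integrable_fst.smul (v 0)
  have h1 := hY.integrable_snd.smul (v 1)
  have key : ∀ m : MeasurableSpace Ω, μ[fun ω => (inner ℝ v (Y ω) : ℝ) | m] =ᵐ[μ]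
      v 0 • μ[fun ω => Y ω 0 | m] + v 1 • μ[fun ω => Y ω 1 | m] := by
    intro m
    rw [h]
    refine (condExp_add h0 h1 m).trans ?_
    exact (condExp_smul _ _ m).add (condExp_smul _ _ m)
  refine (key _).trans (EventuallyEq.trans ?_ (key _).symm)
  exact ((hY.2.2 0).const_smul (v 0)).add ((hY.2.2 1).const_smul (v 1))

variable [IsFiniteMeasure μ]

theorem regr_inner_neg (hY : IsAdmissible F μ X Z Y) (hX : Measurable X) (v : Plane) :
    ∀ᵐ x ∂(μ.map X), regr μ (fun ω => inner ℝ (-v) (Y ω)) X x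
      = -regr μ (fun ω => inner ℝ v (Y ω)) X x := by
  rw [ae_map_iff hX.aemeasurable
    (measurableSet_eq_fun (g := fun x => -regr μ (fun ω => inner ℝ v (Y ω)) X x) measurable_regr
      measurable_regr.neg)]
  have h := condExp_neg (μ := μ) (fun ω => (inner ℝ v (Y ω) : ℝ))
    (MeasurableSpace.comap X inferInstance)
  have h' : (-fun ω => (inner ℝ v (Y ω) : ℝ)) = fun ω => (inner ℝ (-v) (Y ω) : ℝ) := by
    ext ω; simp
  rw [h'] at h
  filter_upwards [h, condExp_ae_eq_regr (hY.integrable_inner v) hX,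
    condExp_ae_eq_regr (hY.integrable_inner (-v)) hX] with ω h1 h2 h3
  rw [← h3, h1, Pi.neg_apply, h2]

theorem ivUpper_ae_eq (hF : IsRandomClosedSet F) (hY : IsAdmissible F μ X Z Y)
    (hX : Measurable X) (hZ : Measurable Z) (v : Plane) :
    ∀ᵐ x ∂(μ.map X), ivUpper F μ X Z v x
      = (regr μ (fun ω => inner ℝ v (Y ω)) X x : EReal) + (margin μ (slack F Y v) X Z x : EReal) :=
  essInf_condMean_ae_eq (hY.measurable_inner v) (hY.integrable_inner v)
    (measurable_supportFun hF v) (hY.inner_le_supportFun v) hX hZ (hY.condExp_inner v)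

theorem ivLower_eq_neg_ivUpper (v : Plane) (x : 𝒳) :
    ivLower F μ X Z v x = -ivUpper F μ X Z (-v) x :=
  essSup_neg_ereal _

theorem ivLower_ae_eq (hF : IsRandomClosedSet F) (hY : IsAdmissible F μ X Z Y)
    (hX : Measurable X) (hZ : Measurable Z) (v : Plane) :
    ∀ᵐ x ∂(μ.map X), ivLower F μ X Z v x
      = (regr μ (fun ω => inner ℝ v (Y ω)) X x : EReal)
        - (margin μ (slack F Y (-v)) X Z x : EReal) := by
  filter_upwards [ivUpper_ae_eq hF hY hX hZ (-v), regr_inner_neg hY hX v] with x h1 h2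
  rw [ivLower_eq_neg_ivUpper, h1, h2, EReal.neg_add (by simp) (by simp), EReal.coe_neg, neg_neg]

/-- The right side is the negative of a real number plus an element of `[0, ∞]`, the shape that
`emean_coe_add` handles. Infinite margins are checked by cases. -/
theorem coe_sub_sub_coe_add (a b : ℝ) (m m' : ℝ≥0∞) :
    ((a : EReal) - (m : EReal)) - ((b : EReal) + (m' : EReal))
      = -(((-(a - b) : ℝ) : EReal) + ((m + m' : ℝ≥0∞) : EReal)) := by
  induction m with
  | top => simp only [EReal.coe_ennreal_top, top_add, EReal.sub_top, EReal.bot_sub,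
      EReal.coe_add_top, EReal.neg_top]
  | coe m =>
    induction m' with
    | top =>
      simp only [EReal.coe_ennreal_top, add_top, EReal.coe_add_top, EReal.neg_top]
      exact EReal.sub_top _
    | coe m' =>
      have : ((a - m - (b + m') : ℝ) : EReal) = ((-(-(a - b) + (m + m')) : ℝ) : EReal) := by
        congr 1; ring
      rw [EReal.coe_ennreal_add]
      exact this

theorem coe_add_sub_coe_sub (a b : ℝ) (m m' : ℝ≥0∞) :
    ((a : EReal) + (m : EReal)) - ((b : EReal) - (m' : EReal))
      = ((a - b : ℝ) : EReal) + ((m + m' : ℝ≥0∞) : EReal) := by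
  induction m' with
  | top =>
    simp only [EReal.coe_ennreal_top, add_top, EReal.coe_add_top, EReal.sub_top]
    rw [EReal.sub_bot]
    exact EReal.add_ne_bot_iff.2 ⟨by simp, by simp⟩
  | coe m' =>
    induction m with
    | top =>
      simp only [EReal.coe_ennreal_top, top_add, EReal.coe_add_top]
      exact EReal.top_sub_coe (b - m' : ℝ)
    | coe m =>
      have : ((a + m - (b - m') : ℝ) : EReal) = ((a - b + (m + m') : ℝ) : EReal) := by
        congr 1; ring
      rw [EReal.coe_ennreal_add]
      exact this

end Bounds

/-! ### Pointwise versions -/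

/-- The null set where `h` is below its essential infimum contains no atom. At a point of continuity
it would contain a whole relative neighbourhood, which has positive mass. -/
theorem essInf_eq_biInf {E : Type*} [TopologicalSpace E] [MeasurableSpace E] {ν : Measure E}
    {s : Set E} (hs : ∀ᵐ z ∂ν, z ∈ s) {h : E → EReal}
    (hpt : ∀ z ∈ s, 0 < ν {z} ∨ ((∀ U ∈ 𝓝[s] z, 0 < ν U) ∧ ContinuousWithinAt h s z)) :
    essInf h ν = ⨅ z ∈ s, h z := by
  have hae : ∀ᵐ z ∂ν, essInf h ν ≤ h z := le_essInf_iff.1 le_rfl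
  refine le_antisymm (le_iInf₂ fun z hz => ?_) ?_
  · by_contra! hlt
    rcases hpt z hz with h1 | ⟨h1, h2⟩
    · refine h1.ne' (measure_mono_null ?_ (ae_iff.1 hae))
      rintro _ rfl
      exact not_le.2 hlt
    · have hU : {y | h y < essInf h ν} ∈ 𝓝[s] z := h2.eventually (gt_mem_nhds hlt)
      refine (h1 _ hU).ne' (measure_mono_null ?_ (ae_iff.1 hae))
      exact fun y hy => not_le.2 hy
  · exact le_essInf_iff.2 (hs.mono fun z hz => iInf₂_le z hz)

theorem IsPointwiseVersion.ivUpper_ae_eq {Ω 𝒳 : Type*} [MeasurableSpace Ω] [MeasurableSpace 𝒳]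
    {dz : ℕ} {μ : Measure Ω} [IsFiniteMeasure μ] {F : Ω → Set Plane} {X : Ω → 𝒳}
    {Z : Ω → EuclideanSpace ℝ (Fin dz)} {𝒵 : Set (EuclideanSpace ℝ (Fin dz))}
    (hX : Measurable X) (hZ : Measurable Z) (h𝒵 : MeasurableSet 𝒵) (hZ𝒵 : ∀ ω, Z ω ∈ 𝒵)
    {v : Plane} {g : 𝒳 → EuclideanSpace ℝ (Fin dz) → EReal}
    (hg : IsPointwiseVersion μ X Z 𝒵 (fun ω => supportFun v (F ω)) g) :
    ∀ᵐ x ∂(μ.map X), ivUpper F μ X Z v x = ⨅ z ∈ 𝒵, g x z := by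
  have hmem : ∀ᵐ p ∂(μ.map fun ω => (X ω, Z ω)), p.2 ∈ 𝒵 := by
    rw [ae_map_iff (hX.prodMk hZ).aemeasurable (measurable_snd h𝒵)]
    exact ae_of_all _ hZ𝒵
  filter_upwards [ae_ae_of_ae_map_prod hZ hg.1, ae_ae_of_ae_map_prod hZ hmem, hg.2]
    with x h1 h2 h3
  rw [← essInf_eq_biInf h2 h3]
  exact essInf_congr_ae (h1.mono fun z hz => hz.symm)

end WelfareGain

namespace WelfareGain

open scoped ENNReal

/-! ### Attaining the lower bound -/

section Attain

variable {Ω 𝒳 : Type*} [MeasurableSpace Ω] [MeasurableSpace 𝒳] {dz : ℕ} {μ : Measure Ω}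
  {F : Ω → Set Plane} {X : Ω → 𝒳} {Z : Ω → EuclideanSpace ℝ (Fin dz)} {Y : Ω → Plane}

theorem welfareGain_swap (δ δ' : 𝒳 → Bool) :
    welfareGain μ X δ' δ Y = -welfareGain μ X δ δ' Y := by
  rw [welfareGain, welfareGain, ← integral_neg]
  congr 1 with ω
  ring

/-- At each `x` at most one indicator is nonzero, so negation distributes even for infinite bounds.
It turns statements on the upper endpoint into statements on the lower endpoint for the exchanged
rules. -/
theorem gainIntegrand_swap {𝒳 : Type*} (A B : 𝒳 → EReal) (δ δ' : 𝒳 → Bool) (x : 𝒳) :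
    gainIntegrand B A δ δ' x = -gainIntegrand A B δ' δ x := by
  unfold gainIntegrand newlyTreated
  cases δ x <;> cases δ' x <;> simp

/-- The covariate values at which `δ` treats and `δ'` does not. -/
def switchSet (δ δ' : 𝒳 → Bool) : Set 𝒳 := {x | δ x = true ∧ δ' x = false}

theorem measurableSet_switchSet {δ δ' : 𝒳 → Bool} (hδ : Measurable δ) (hδ' : Measurable δ') :
    MeasurableSet (switchSet δ δ') :=
  (hδ (measurableSet_singleton true)).inter (hδ' (measurableSet_singleton false))

theorem disjoint_switchSet {𝒳 : Type*} (δ δ' : 𝒳 → Bool) :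
    Disjoint (switchSet δ δ') (switchSet δ' δ) := by
  rw [Set.disjoint_left]
  rintro x ⟨h1, -⟩ ⟨-, h2⟩
  simp [h1] at h2

theorem measurable_treat {δ : 𝒳 → Bool} (hδ : Measurable δ) : Measurable (treat δ) :=
  Measurable.ite (hδ (measurableSet_singleton true)) measurable_const measurable_const

theorem abs_treat_sub_treat_le {𝒳 : Type*} (δ δ' : 𝒳 → Bool) (x : 𝒳) :
    ‖treat δ x - treat δ' x‖ ≤ 1 := by
  unfold treat
  cases δ x <;> cases δ' x <;> simp

theorem integrable_mul_treat {f : Ω → ℝ} (hf : Integrable f μ) (hX : Measurable X)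
    {δ δ' : 𝒳 → Bool} (hδ : Measurable δ) (hδ' : Measurable δ') :
    Integrable (fun ω => f ω * (treat δ (X ω) - treat δ' (X ω))) μ :=
  hf.mul_bdd (c := 1)
    (((measurable_treat hδ).comp hX).sub ((measurable_treat hδ').comp hX)).aestronglyMeasurable
    (ae_of_all _ fun ω => abs_treat_sub_treat_le δ δ' (X ω))

/-- Lowering the treated mean where `δ` newly treats and raising it where `δ` stops treating, and
conversely for the untreated mean, lowers the gain by the total of the moves. -/
theorem shift_mul_treat {𝒳 : Type*} {δ δ' : 𝒳 → Bool} {ρ ρ₁ ρ₀ : 𝒳 → ℝ≥0∞} {x : 𝒳}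
    (hsum : ρ₁ x + ρ₀ x = ρ x) (htop : ρ x ≠ ⊤)
    (h0 : x ∉ switchSet δ δ' → x ∉ switchSet δ' δ → ρ x = 0) :
    (((switchSet δ' δ).indicator ρ₁ x).toReal - ((switchSet δ δ').indicator ρ₁ x).toReal
      - (((switchSet δ δ').indicator ρ₀ x).toReal - ((switchSet δ' δ).indicator ρ₀ x).toReal))
      * (treat δ x - treat δ' x) = -(ρ x).toReal := by
  have h1 : ρ₁ x ≠ ⊤ := ne_top_of_le_ne_top htop (hsum ▸ le_self_add)
  have h2 : ρ₀ x ≠ ⊤ := ne_top_of_le_ne_top htop (hsum ▸ le_add_self)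
  have h3 : (ρ x).toReal = (ρ₁ x).toReal + (ρ₀ x).toReal := by
    rw [← hsum, ENNReal.toReal_add h1 h2]
  by_cases hP : x ∈ switchSet δ δ'
  · have hQ := Set.disjoint_left.1 (disjoint_switchSet δ δ') hP
    have ht : treat δ x - treat δ' x = 1 := by simp [treat, hP.1, hP.2]
    simp only [Set.indicator_of_mem hP, Set.indicator_of_notMem hQ, ht, h3, ENNReal.toReal_zero]
    ring
  · by_cases hQ : x ∈ switchSet δ' δ
    · have ht : treat δ x - treat δ' x = -1 := by simp [treat, hQ.1, hQ.2]
      simp only [Set.indicator_of_mem hQ, Set.indicator_of_notMem hP, ht, h3,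
        ENNReal.toReal_zero]
      ring
    · simp [hP, hQ, h0 hP hQ]

/-- The amount by which the means of `Y₁` and of `Y₀` can be moved to lower the gain. -/
noncomputable def lossMargin (μ : Measure Ω) [IsFiniteMeasure μ] (F : Ω → Set Plane)
    (X : Ω → 𝒳) (Z : Ω → EuclideanSpace ℝ (Fin dz)) (Y : Ω → Plane) (δ δ' : 𝒳 → Bool) (v : Plane)
    (x : 𝒳) : ℝ≥0∞ :=
  (switchSet δ δ').indicator (margin μ (slack F Y (-v)) X Z) x
    + (switchSet δ' δ).indicator (margin μ (slack F Y v) X Z) x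

variable [IsFiniteMeasure μ]

theorem measurable_lossMargin {δ δ' : 𝒳 → Bool} (hδ : Measurable δ) (hδ' : Measurable δ')
    (v : Plane) : Measurable (lossMargin μ F X Z Y δ δ' v) :=
  (measurable_margin.indicator (measurableSet_switchSet hδ hδ')).add
    (measurable_margin.indicator (measurableSet_switchSet hδ' hδ))

/-- Where `δ` newly treats, the gain falls by lowering `Y₁` (margin in direction `-v₁`) and raising
`Y₀` (direction `v₀`). Where it stops treating, the signs reverse. -/
theorem gainIntegrand_ae_eq (hF : IsRandomClosedSet F) (hY : IsAdmissible F μ X Z Y)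
    (hX : Measurable X) (hZ : Measurable Z) (δ δ' : 𝒳 → Bool) :
    ∀ᵐ x ∂(μ.map X), gainIntegrand
        (fun x => ivLower F μ X Z v₁ x - ivUpper F μ X Z v₀ x)
        (fun x => ivUpper F μ X Z v₁ x - ivLower F μ X Z v₀ x) δ δ' x
      = -(((-((regr μ (fun ω => inner ℝ v₁ (Y ω)) X x - regr μ (fun ω => inner ℝ v₀ (Y ω)) X x)
            * (treat δ x - treat δ' x)) : ℝ) : EReal)
          + ((lossMargin μ F X Z Y δ δ' v₁ x + lossMargin μ F X Z Y δ' δ v₀ x : ℝ≥0∞) : EReal)) := by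
  filter_upwards [ivLower_ae_eq hF hY hX hZ v₁, ivLower_ae_eq hF hY hX hZ v₀,
    ivUpper_ae_eq hF hY hX hZ v₁, ivUpper_ae_eq hF hY hX hZ v₀] with x h1 h2 h3 h4
  simp only [gainIntegrand, h1, h2, h3, h4, coe_sub_sub_coe_add, coe_add_sub_coe_sub,
    lossMargin, newlyTreated, treat]
  by_cases hP : x ∈ switchSet δ δ'
  · have hQ := Set.disjoint_left.1 (disjoint_switchSet δ δ') hP
    simp only [Set.indicator_of_mem hP, Set.indicator_of_notMem hQ, hP.1, hP.2]
    simp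
  · by_cases hQ : x ∈ switchSet δ' δ
    · simp only [Set.indicator_of_mem hQ, Set.indicator_of_notMem hP, hQ.1, hQ.2]
      simp [add_comm]
    · have hδ : δ x = δ' x := by
        simp only [switchSet, Set.mem_ofPred_eq] at hP hQ
        revert hP hQ
        cases δ x <;> cases δ' x <;> simp
      simp only [Set.indicator_of_notMem hQ, Set.indicator_of_notMem hP, hδ]
      cases δ' x <;> simp

theorem welfareGain_eq_integral_regr (hY : IsAdmissible F μ X Z Y) (hX : Measurable X)
    (δ δ' : 𝒳 → Bool) :
    welfareGain μ X δ δ' Y = ∫ ω, (regr μ (fun ω => inner ℝ v₁ (Y ω)) X (X ω)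
      - regr μ (fun ω => inner ℝ v₀ (Y ω)) X (X ω)) * (treat δ (X ω) - treat δ' (X ω)) ∂μ := by
  refine integral_congr_ae ?_
  filter_upwards [condExp_sub hY.integrable_fst hY.integrable_snd
    (MeasurableSpace.comap X inferInstance), condExp_ae_eq_regr (hY.integrable_inner v₁) hX,
    condExp_ae_eq_regr (hY.integrable_inner v₀) hX] with ω h1 h2 h3
  rw [← h2, ← h3]
  simp only [inner_v₁, inner_v₀]
  exact congrArg (· * _) h1

theorem integrable_regr (hf : Integrable f μ) (hX : Measurable X) :
    Integrable (fun ω => regr μ f X (X ω)) μ :=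
  (integrable_congr (condExp_ae_eq_regr hf hX)).1 integrable_condExp

/-- The lower end of the interval lies below the gain of an admissible pair by the total loss
margin. -/
theorem emean_gainIntegrand (hF : IsRandomClosedSet F) (hY : IsAdmissible F μ X Z Y)
    (hX : Measurable X) (hZ : Measurable Z) {δ δ' : 𝒳 → Bool} (hδ : Measurable δ)
    (hδ' : Measurable δ') {Δlo Δhi : 𝒳 → EReal}
    (hΔlo : ∀ᵐ x ∂(μ.map X), Δlo x = ivLower F μ X Z v₁ x - ivUpper F μ X Z v₀ x)
    (hΔhi : ∀ᵐ x ∂(μ.map X), Δhi x = ivUpper F μ X Z v₁ x - ivLower F μ X Z v₀ x) :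
    HasMean μ (fun ω => gainIntegrand Δlo Δhi δ δ' (X ω)) ∧
      emean μ (fun ω => gainIntegrand Δlo Δhi δ δ' (X ω))
        = (welfareGain μ X δ δ' Y : EReal)
          - ((∫⁻ x, (lossMargin μ F X Z Y δ δ' v₁ x + lossMargin μ F X Z Y δ' δ v₀ x)
              ∂(μ.map X) : ℝ≥0∞) : EReal) := by
  have hGm : Measurable fun x =>
      lossMargin μ F X Z Y δ δ' v₁ x + lossMargin μ F X Z Y δ' δ v₀ x :=
    (measurable_lossMargin hδ hδ' v₁).add (measurable_lossMargin hδ' hδ v₀)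
  have hcm : Measurable fun ω => -((regr μ (fun ω => inner ℝ v₁ (Y ω)) X (X ω)
      - regr μ (fun ω => inner ℝ v₀ (Y ω)) X (X ω)) * (treat δ (X ω) - treat δ' (X ω))) :=
    (((measurable_regr.comp hX).sub (measurable_regr.comp hX)).mul
      (((measurable_treat hδ).comp hX).sub ((measurable_treat hδ').comp hX))).neg
  have hci := (integrable_mul_treat ((integrable_regr (hY.integrable_inner v₁) hX).sub
    (integrable_regr (hY.integrable_inner v₀) hX)) hX hδ hδ').neg
  obtain ⟨h1, h2⟩ := emean_coe_add hcm hci (hGm.comp hX)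
  have hae : (fun ω => gainIntegrand Δlo Δhi δ δ' (X ω)) =ᵐ[μ] fun ω =>
      gainIntegrand (fun x => ivLower F μ X Z v₁ x - ivUpper F μ X Z v₀ x)
        (fun x => ivUpper F μ X Z v₁ x - ivLower F μ X Z v₀ x) δ δ' (X ω) := by
    filter_upwards [ae_of_ae_map hX.aemeasurable hΔlo, ae_of_ae_map hX.aemeasurable hΔhi]
      with ω h4 h5
    rw [gainIntegrand, gainIntegrand, h4, h5]
  replace hae := hae.trans (ae_of_ae_map hX.aemeasurable (gainIntegrand_ae_eq hF hY hX hZ δ δ'))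
  refine ⟨h1.neg.congr_ae hae.symm, ?_⟩
  rw [emean_congr_ae hae, welfareGain_eq_integral_regr hY hX, lintegral_map hGm hX]
  refine (emean_neg h1).trans ?_
  rw [h2, EReal.neg_add (by simp) (by simp), integral_neg, EReal.coe_neg, neg_neg]
  rfl

/-! ### Sharpness of the bounds -/

theorem exists_isAdmissible_welfareGain_sub {𝒴₁ 𝒴₀ : Ω → Set ℝ}
    (hF : IsRandomClosedSet (prodSet 𝒴₁ 𝒴₀))
    (hconv : ∀ᵐ ω ∂μ, Convex ℝ (prodSet 𝒴₁ 𝒴₀ ω))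
    (hY : IsAdmissible (prodSet 𝒴₁ 𝒴₀) μ X Z Y) (hX : Measurable X) (hZ : Measurable Z)
    {δ δ' : 𝒳 → Bool} (hδ : Measurable δ) (hδ' : Measurable δ') {t : ℝ} (ht : 0 ≤ t)
    (hle : ENNReal.ofReal t ≤ ∫⁻ x, (lossMargin μ (prodSet 𝒴₁ 𝒴₀) X Z Y δ δ' v₁ x
      + lossMargin μ (prodSet 𝒴₁ 𝒴₀) X Z Y δ' δ v₀ x) ∂(μ.map X)) :
    ∃ Y', IsAdmissible (prodSet 𝒴₁ 𝒴₀) μ X Z Y' ∧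
      welfareGain μ X δ δ' Y' = welfareGain μ X δ δ' Y - t := by
  set F := prodSet 𝒴₁ 𝒴₀ with hFdef
  set G₁ := lossMargin μ F X Z Y δ δ' v₁ with hG₁
  set G₀ := lossMargin μ F X Z Y δ' δ v₀ with hG₀
  have hG₁m : Measurable G₁ := measurable_lossMargin hδ hδ' v₁
  have hG₀m : Measurable G₀ := measurable_lossMargin hδ' hδ v₀
  obtain ⟨ρ, hρm, hρG, hρt⟩ := exists_le_lintegral_eq (ν := μ.map X) (hG₁m.add hG₀m) hle
  have hρfin : ∫⁻ x, ρ x ∂(μ.map X) ≠ ⊤ := by rw [hρt]; exact ENNReal.ofReal_ne_top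
  -- The move is split greedily: `Y₁` takes as much of `ρ` as its margin `G₁` allows, and the
  -- remainder is at most `G₀` and goes to `Y₀`.
  set ρ₁ : 𝒳 → ℝ≥0∞ := fun x => min (ρ x) (G₁ x) with hρ₁
  set ρ₀ : 𝒳 → ℝ≥0∞ := fun x => ρ x - G₁ x with hρ₀
  have hsum : ∀ x, ρ₁ x + ρ₀ x = ρ x := by
    intro x
    simp only [hρ₁, hρ₀]
    rcases le_total (ρ x) (G₁ x) with h | h
    · rw [min_eq_left h, tsub_eq_zero_of_le h, add_zero]
    · rw [min_eq_right h, add_tsub_cancel_of_le h]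
  obtain ⟨u₁, hu₁m, hu₁i, hu₁l, hu₁u, hu₁W, hu₁X⟩ := exists_shift (μ := μ)
    (hY.measurable_slack hF (-v₁)) (hY.measurable_slack hF v₁) hX hZ
    (measurableSet_switchSet hδ hδ') (measurableSet_switchSet hδ' hδ) (disjoint_switchSet δ δ')
    (ρ := ρ₁) (hρm.min hG₁m) (fun x => min_le_right _ _)
    (ne_top_of_le_ne_top hρfin (lintegral_mono fun x => min_le_left _ _))
  -- The two switch sets are exchanged here because `Y₀` enters the gain with the opposite sign.
  obtain ⟨u₀, hu₀m, hu₀i, hu₀l, hu₀u, hu₀W, hu₀X⟩ := exists_shift (μ := μ)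
    (hY.measurable_slack hF (-v₀)) (hY.measurable_slack hF v₀) hX hZ
    (measurableSet_switchSet hδ' hδ) (measurableSet_switchSet hδ hδ') (disjoint_switchSet δ' δ)
    (ρ := ρ₀) (hρm.sub hG₁m) (fun x => tsub_le_iff_left.2 (hρG x))
    (ne_top_of_le_ne_top hρfin (lintegral_mono fun x => tsub_le_self))
  set Y' : Ω → Plane := fun ω => Y ω + (u₁ ω • v₁ + u₀ ω • v₀) with hY'
  have hY'0 : (fun ω => Y' ω 0) = (fun ω => Y ω 0) + u₁ := by
    ext ω; simp [hY', v₁, v₀]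
  have hY'1 : (fun ω => Y' ω 1) = (fun ω => Y ω 1) + u₀ := by
    ext ω; simp [hY', v₁, v₀]
  have hadd₁ := fun m => condExp_add hY.integrable_fst hu₁i m
  have hadd₀ := fun m => condExp_add hY.integrable_snd hu₀i m
  have hadm : IsAdmissible F μ X Z Y' := by
    refine ⟨⟨?_, ?_⟩, ?_, ?_⟩
    · exact hY.1.1.add ((hu₁m.smul_const v₁).add (hu₀m.smul_const v₀))
    · filter_upwards [hY.1.2, hconv] with ω h1 h2
      exact add_mem_prodSet (hF.1 ω) h2 h1 (hu₁u ω) (hu₁l ω) (hu₀u ω) (hu₀l ω)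
    · exact hY.2.1.add ((hu₁i.smul_const v₁).add (hu₀i.smul_const v₀))
    · intro i
      fin_cases i
      · change μ[fun ω => Y' ω 0 | _] =ᵐ[μ] μ[fun ω => Y' ω 0 | _]
        rw [hY'0]
        -- The conditional means of the move given `(X, Z)` and given `X` are the same function of
        -- `X`.
        exact (hadd₁ _).trans (((hY.2.2 0).add (hu₁W.trans hu₁X.symm)).trans (hadd₁ _).symm)
      · change μ[fun ω => Y' ω 1 | _] =ᵐ[μ] μ[fun ω => Y' ω 1 | _]
        rw [hY'1]
        exact (hadd₀ _).trans (((hY.2.2 1).add (hu₀W.trans hu₀X.symm)).trans (hadd₀ _).symm)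
  refine ⟨Y', hadm, ?_⟩
  have hsub := condExp_sub hY.integrable_fst hY.integrable_snd
    (MeasurableSpace.comap X inferInstance)
  have hsub' := condExp_sub hadm.integrable_fst hadm.integrable_snd
    (MeasurableSpace.comap X inferInstance)
  have hρXfin : ∫⁻ ω, ρ (X ω) ∂μ ≠ ⊤ := by rwa [← lintegral_map hρm hX]
  have hgain : welfareGain μ X δ δ' Y' = ∫ ω,
      ((μ[fun ω => Y ω 0 - Y ω 1 | MeasurableSpace.comap X inferInstance]) ω *
        (treat δ (X ω) - treat δ' (X ω)) - (ρ (X ω)).toReal) ∂μ := by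
    refine integral_congr_ae ?_
    rw [hY'0, hY'1] at hsub'
    filter_upwards [hsub, hsub', hadd₁ (MeasurableSpace.comap X inferInstance),
      hadd₀ (MeasurableSpace.comap X inferInstance), hu₁X, hu₀X,
      ae_lt_top (hρm.comp hX) hρXfin] with ω h1 h2 h3 h4 h5 h6 h7
    have h8 := shift_mul_treat (δ := δ) (δ' := δ') (hsum (X ω)) h7.ne (fun hP hQ => by
      have := hρG (X ω)
      simpa [hG₁, hG₀, lossMargin, hP, hQ] using this)
    have e1 : (μ[fun ω => Y ω 0 - Y ω 1 | MeasurableSpace.comap X inferInstance]) ω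
        = (μ[fun ω => Y ω 0 | MeasurableSpace.comap X inferInstance]) ω
          - (μ[fun ω => Y ω 1 | MeasurableSpace.comap X inferInstance]) ω := h1
    have e2 : (μ[fun ω => Y' ω 0 - Y' ω 1 | MeasurableSpace.comap X inferInstance]) ω
        = (μ[(fun ω => Y ω 0) + u₁ | MeasurableSpace.comap X inferInstance]) ω
          - (μ[(fun ω => Y ω 1) + u₀ | MeasurableSpace.comap X inferInstance]) ω := by
      rw [← hY'0, ← hY'1] at h2 ⊢
      exact h2
    rw [e1, e2, h3, h4, Pi.add_apply, Pi.add_apply, h5, h6, sub_eq_add_neg _ (ρ (X ω)).toReal,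
      ← h8]
    ring
  rw [hgain, integral_sub (integrable_mul_treat integrable_condExp hX hδ hδ')
    (integrable_toReal_of_lintegral_ne_top (f := fun ω => ρ (X ω)) (hρm.comp hX).aemeasurable
      hρXfin),
    integral_toReal (f := fun ω => ρ (X ω)) (hρm.comp hX).aemeasurable
      (ae_lt_top (hρm.comp hX) hρXfin)]
  have : ∫⁻ ω, ρ (X ω) ∂μ = ENNReal.ofReal t := by
    rw [← hρt, lintegral_map hρm hX]
  rw [this, ENNReal.toReal_ofReal ht]
  rfl

/-- The bounds are prescribed only almost everywhere, so that one statement covers both essential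
and pointwise suprema and infima. -/
theorem identifiedSet_eq_gainInterval {𝒴₁ 𝒴₀ : Ω → Set ℝ}
    (hF : IsRandomClosedSet (prodSet 𝒴₁ 𝒴₀))
    (hconv : ∀ᵐ ω ∂μ, Convex ℝ (prodSet 𝒴₁ 𝒴₀ ω))
    (hY : IsAdmissible (prodSet 𝒴₁ 𝒴₀) μ X Z Y) (hX : Measurable X) (hZ : Measurable Z)
    {δ δ' : 𝒳 → Bool} (hδ : Measurable δ) (hδ' : Measurable δ') {Δlo Δhi : 𝒳 → EReal}
    (hΔlo : ∀ᵐ x ∂(μ.map X), Δlo x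
      = ivLower (prodSet 𝒴₁ 𝒴₀) μ X Z v₁ x - ivUpper (prodSet 𝒴₁ 𝒴₀) μ X Z v₀ x)
    (hΔhi : ∀ᵐ x ∂(μ.map X), Δhi x
      = ivUpper (prodSet 𝒴₁ 𝒴₀) μ X Z v₁ x - ivLower (prodSet 𝒴₁ 𝒴₀) μ X Z v₀ x) :
    identifiedSet (prodSet 𝒴₁ 𝒴₀) μ X Z δ δ' = gainInterval μ X δ δ' Δlo Δhi := by
  have hupper : ∀ β : ℝ, (β : EReal) ≤ emean μ (fun ω => gainIntegrand Δhi Δlo δ δ' (X ω)) ↔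
      emean μ (fun ω => gainIntegrand Δlo Δhi δ' δ (X ω)) ≤ ((-β : ℝ) : EReal) := by
    intro β
    simp_rw [gainIntegrand_swap Δlo Δhi δ δ']
    rw [emean_neg (emean_gainIntegrand hF hY hX hZ hδ' hδ hΔlo hΔhi).1, EReal.coe_neg]
    exact EReal.le_neg
  have hlower : ∀ (ε ε' : 𝒳 → Bool) (Y' : Ω → Plane), Measurable ε → Measurable ε' →
      IsAdmissible (prodSet 𝒴₁ 𝒴₀) μ X Z Y' →
      emean μ (fun ω => gainIntegrand Δlo Δhi ε ε' (X ω)) ≤ (welfareGain μ X ε ε' Y' : EReal) := by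
    intro ε ε' Y' hε hε' hY'
    rw [(emean_gainIntegrand hF hY' hX hZ hε hε' hΔlo hΔhi).2]
    exact EReal.sub_le_of_le_add (le_add_of_nonneg_right (EReal.coe_ennreal_nonneg _))
  have hattain : ∀ (ε ε' : 𝒳 → Bool) (β : ℝ), Measurable ε → Measurable ε' →
      β ≤ welfareGain μ X ε ε' Y →
      emean μ (fun ω => gainIntegrand Δlo Δhi ε ε' (X ω)) ≤ (β : EReal) →
      ∃ Y', IsAdmissible (prodSet 𝒴₁ 𝒴₀) μ X Z Y' ∧ welfareGain μ X ε ε' Y' = β := by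
    intro ε ε' β hε hε' hβ hle
    rw [(emean_gainIntegrand hF hY hX hZ hε hε' hΔlo hΔhi).2] at hle
    obtain ⟨Y', h1, h2⟩ := exists_isAdmissible_welfareGain_sub hF hconv hY hX hZ hε hε'
      -- The inequality gain minus margin `≤ β` is solved for the margin, which may be infinite.
      (sub_nonneg.2 hβ) (by
        rw [EReal.sub_le_iff_le_add (by simp) (by simp), add_comm,
          ← EReal.sub_le_iff_le_add (by simp) (by simp), ← EReal.coe_sub] at hle
        have := EReal.toENNReal_le_toENNReal hle
        rwa [EReal.toENNReal_coe, EReal.real_coe_toENNReal] at this)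
    exact ⟨Y', h1, by rw [h2]; ring⟩
  ext β
  simp only [identifiedSet, gainInterval, Set.mem_ofPred_eq, hupper]
  constructor
  · rintro ⟨Y', hY', rfl⟩
    refine ⟨hlower δ δ' Y' hδ hδ' hY', ?_⟩
    rw [← welfareGain_swap]
    exact hlower δ' δ Y' hδ' hδ hY'
  · rintro ⟨h1, h2⟩
    -- Values below the gain of the true outcomes are reached by lowering it; values above, by
    -- lowering the gain of the exchanged rules.
    rcases le_total β (welfareGain μ X δ δ' Y) with h | h
    · obtain ⟨Y', h3, h4⟩ := hattain δ δ' β hδ hδ' h h1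
      exact ⟨Y', h3, h4.symm⟩
    · obtain ⟨Y', h3, h4⟩ := hattain δ' δ (-β) hδ' hδ
        (by rw [welfareGain_swap]; linarith) h2
      refine ⟨Y', h3, ?_⟩
      rw [welfareGain_swap] at h4
      linarith

end Attain

end WelfareGain

/-! ### The sharp identified interval -/

open WelfareGain in
theorem theorem2 {Ω : Type*} [MeasurableSpace Ω] (μ : Measure Ω) [IsProbabilityMeasure μ]
    {dx dz : ℕ} (𝒳 : Set (EuclideanSpace ℝ (Fin dx))) (𝒵 : Set (EuclideanSpace ℝ (Fin dz)))
    (X : Ω → 𝒳) (hX : Measurable X)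
    (Z : Ω → EuclideanSpace ℝ (Fin dz)) (hZ : Measurable Z)
    (h𝒵 : MeasurableSet 𝒵) (hZ𝒵 : ∀ ω, Z ω ∈ 𝒵)
    -- the random set, integrable and almost surely convex
    (𝒴₁ 𝒴₀ : Ω → Set ℝ)
    (hF : IsIntegrableRandomSet (prodSet 𝒴₁ 𝒴₀) μ)
    (hconv : ∀ᵐ ω ∂μ, Convex ℝ (prodSet 𝒴₁ 𝒴₀ ω))
    -- the true potential outcomes, for which the instrument is mean independent
    (Y : Ω → Plane) (hY : IsAdmissible (prodSet 𝒴₁ 𝒴₀) μ X Z Y)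
    -- the treatment rules
    (δ δ' : 𝒳 → Bool) (hδ : Measurable δ) (hδ' : Measurable δ')
    -- the bounds on the conditional average treatment effect
    (Δlo Δhi : 𝒳 → EReal)
    (hΔlo : Δlo = fun x =>
      ivLower (prodSet 𝒴₁ 𝒴₀) μ X Z v₁ x - ivUpper (prodSet 𝒴₁ 𝒴₀) μ X Z v₀ x)
    (hΔhi : Δhi = fun x =>
      ivUpper (prodSet 𝒴₁ 𝒴₀) μ X Z v₁ x - ivLower (prodSet 𝒴₁ 𝒴₀) μ X Z v₀ x) :
    -- no expectation or difference in the bounds is of the form `∞ - ∞`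
    ((∀ v : Plane, ∀ᵐ p ∂(μ.map fun ω => (X ω, Z ω)),
        HasMean (condDistrib (fun ω => supportFun v (prodSet 𝒴₁ 𝒴₀ ω))
          (fun ω => (X ω, Z ω)) μ p) id) ∧
      (∀ v : Plane, ∀ᵐ x ∂(μ.map X),
        ivLower (prodSet 𝒴₁ 𝒴₀) μ X Z v x ≠ ⊤ ∧ ivUpper (prodSet 𝒴₁ 𝒴₀) μ X Z v x ≠ ⊥) ∧
      HasMean μ (fun ω => gainIntegrand Δlo Δhi δ δ' (X ω)) ∧
      HasMean μ (fun ω => gainIntegrand Δhi Δlo δ δ' (X ω))) ∧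
    -- the sharp identified region is the interval `[β_l, β_u]`
    identifiedSet (prodSet 𝒴₁ 𝒴₀) μ X Z δ δ' = gainInterval μ X δ δ' Δlo Δhi ∧
    -- the same with `sup` and `inf` over all points `z ∈ 𝒵`
    ∀ g : Plane → 𝒳 → EuclideanSpace ℝ (Fin dz) → EReal,
      (∀ v ∈ ({v₁, -v₁, v₀, -v₀} : Set Plane),
        IsPointwiseVersion μ X Z 𝒵 (fun ω => supportFun v (prodSet 𝒴₁ 𝒴₀ ω)) (g v)) →
      identifiedSet (prodSet 𝒴₁ 𝒴₀) μ X Z δ δ' = gainInterval μ X δ δ'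
        (fun x => (⨆ z ∈ 𝒵, -g (-v₁) x z) - ⨅ z ∈ 𝒵, g v₀ x z)
        (fun x => (⨅ z ∈ 𝒵, g v₁ x z) - ⨆ z ∈ 𝒵, -g (-v₀) x z) := by
  have hFr := hF.1
  have hlo : ∀ᵐ x ∂(μ.map X), Δlo x
      = ivLower (prodSet 𝒴₁ 𝒴₀) μ X Z v₁ x - ivUpper (prodSet 𝒴₁ 𝒴₀) μ X Z v₀ x :=
    ae_of_all _ fun x => congrFun hΔlo x
  have hhi : ∀ᵐ x ∂(μ.map X), Δhi x
      = ivUpper (prodSet 𝒴₁ 𝒴₀) μ X Z v₁ x - ivLower (prodSet 𝒴₁ 𝒴₀) μ X Z v₀ x :=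
    ae_of_all _ fun x => congrFun hΔhi x
  refine ⟨⟨fun v => ?_, fun v => ?_, ?_, ?_⟩, ?_, fun g hg => ?_⟩
  · exact (condMean_ae_eq (hY.measurable_inner v) (hY.integrable_inner v)
      (measurable_supportFun hFr v) (hY.inner_le_supportFun v) (hX.prodMk hZ)).mono
        fun p hp => hp.1
  · filter_upwards [ivLower_ae_eq hFr hY hX hZ v, ivUpper_ae_eq hFr hY hX hZ v] with x h1 h2
    rw [h1, h2]
    constructor
    · refine ((EReal.sub_le_of_le_add (le_add_of_nonneg_right
        (EReal.coe_ennreal_nonneg _))).trans_lt (EReal.coe_lt_top _)).ne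
    · exact EReal.add_ne_bot_iff.2 ⟨by simp, by simp⟩
  · exact (emean_gainIntegrand hFr hY hX hZ hδ hδ' hlo hhi).1
  · simp_rw [gainIntegrand_swap Δlo Δhi δ δ']
    exact (emean_gainIntegrand hFr hY hX hZ hδ' hδ hlo hhi).1.neg
  · exact identifiedSet_eq_gainInterval hFr hconv hY hX hZ hδ hδ' hlo hhi
  -- The pointwise bounds agree almost everywhere with the essential ones, which is all that
  -- `identifiedSet_eq_gainInterval` needs.
  · have hU : ∀ v ∈ ({v₁, -v₁, v₀, -v₀} : Set Plane), ∀ᵐ x ∂(μ.map X),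
        ivUpper (prodSet 𝒴₁ 𝒴₀) μ X Z v x = ⨅ z ∈ 𝒵, g v x z :=
      fun v hv => (hg v hv).ivUpper_ae_eq hX hZ h𝒵 hZ𝒵
    have hneg : ∀ (v : Plane) (x : 𝒳), (⨆ z ∈ 𝒵, -g v x z) = -⨅ z ∈ 𝒵, g v x z := by
      intro v x
      refine eq_of_forall_ge_iff fun c => ?_
      rw [iSup₂_le_iff, EReal.neg_le, le_iInf₂_iff]
      simp_rw [EReal.neg_le]
    refine identifiedSet_eq_gainInterval hFr hconv hY hX hZ hδ hδ' ?_ ?_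
    · filter_upwards [hU (-v₁) (by simp), hU v₀ (by simp)] with x h1 h2
      rw [ivLower_eq_neg_ivUpper, h1, h2, hneg]
    · filter_upwards [hU v₁ (by simp), hU (-v₀) (by simp)] with x h1 h2
      rw [ivLower_eq_neg_ivUpper, h1, h2, hneg]
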